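/- Let $p$ be a prime, let $V\subseteq\mathbb{Q}_p^n$ be an algebraic set (the common zeros in $\mathbb{Q}_p^n$ of some polynomials), and let $A=V\cap\mathbb{Z}_p^n$. Write $I(V)\subseteq\mathbb{Q}_p[x_1,\dots,x_n]$ for the ideal of polynomials vanishing on $V$. For $U\subseteq\mathbb{Z}_p^n$ and $m\ge 0$ let $N_m(U)$ be the number of elements of the image of $U$ in $(\mathbb{Z}/p^m\mathbb{Z})^n$, and let $B(x;p^{-\ell})=x+p^\ell\mathbb{Z}_p^n$. A point $x\in A$ is called a smooth point of dimension $d$ if both the local ring of $V$ at $x$ (the localization of $\mathbb{Q}_p[x_1,\dots,x_n]/I(V)$ at the maximal ideal of $x$) and the Zariski tangent space of $V$ at $x$ have dimension $d$. (1) Let $X\subseteq A$ be a compact and relatively open subset of $A$, all of whose points are smooth points of dimension $d$ (for example, any compact open subset of $A$ when $A$ is a smooth algebraic set of dimension $d$). Then there is an integer $m_0=m_0(X)>0$ such that for all $m\ge m_0$ $$N_m(X)=p^{(m-m_0)d}\,N_{m_0}(X).$$ (2) Let $x\in A$ be a smooth point of dimension $d$. Then there is an integer $m_x>0$ such that for all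 $\ell_1\ge\ell_2\ge m_x$ $$N_{\ell_1}\bigl(A\cap B(x;p^{-\ell_2})\bigr)=p^{(\ell_1-\ell_2)d}.$$ Furthermore, let $r=n-d$ and let $\mathbf f=(f_1,\dots,f_r)$ be local equations of $V$ at $x$, that is, elements of $I(V)\cap\mathbb{Z}_p[x_1,\dots,x_n]$ which generate this ideal after localization at the prime ideal of all polynomials vanishing at $x$; let $|J_{\mathbf f}(x)|$ be the maximum of the absolute values of the $r\times r$ minors of the Jacobian matrix of $\mathbf f$ at $x$. Then every integer $m_x>0$ with $m_x\ge-\log_p|J_{\mathbf f}(x)|^2$ has this property. -/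

import Mathlib

namespace PadicSet

noncomputable section

/-- A subset of `ℚ_p^n` is algebraic if it is the set of common zeros of an ideal of polynomials. -/
def IsAlgebraic {p : ℕ} [Fact p.Prime] {n : ℕ} (V : Set (Fin n → ℚ_[p])) : Prop :=
  ∃ I : Ideal (MvPolynomial (Fin n) ℚ_[p]), V = MvPolynomial.zeroLocus ℚ_[p] I

/-- The vector of `ℚ_p^n` with the same coordinates as a vector of `ℤ_p^n`. -/
def toRat {p : ℕ} [Fact p.Prime] {n : ℕ} (x : Fin n → ℤ_[p]) : Fin n → ℚ_[p] :=
  fun i => (x i : ℚ_[p])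

/-- The points of `V` with coordinates in `ℤ_p`, that is `V ∩ ℤ_p^n`, as a subset of `ℤ_p^n`. -/
def integralPoints {p : ℕ} [Fact p.Prime] {n : ℕ} (V : Set (Fin n → ℚ_[p])) :
    Set (Fin n → ℤ_[p]) :=
  {x | toRat x ∈ V}

/-- The ideal `I(V) ⊆ ℚ_p[x_1, …, x_n]` of all polynomials that vanish on `V`. -/
def idealOf {p : ℕ} [Fact p.Prime] {n : ℕ} (V : Set (Fin n → ℚ_[p])) :
    Ideal (MvPolynomial (Fin n) ℚ_[p]) :=
  MvPolynomial.vanishingIdeal ℚ_[p] V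

/-- The ideal `I(V) ∩ ℤ_p[x_1, …, x_n]`. -/
def integralIdealOf {p : ℕ} [Fact p.Prime] {n : ℕ} (V : Set (Fin n → ℚ_[p])) :
    Ideal (MvPolynomial (Fin n) ℤ_[p]) :=
  (idealOf V).comap (MvPolynomial.map (algebraMap ℤ_[p] ℚ_[p]))

/-- The Zariski tangent space of `V` at `a`: the vectors on which the differentials at `a` of all
polynomials in `I(V)` vanish. -/
def tangentSpace {p : ℕ} [Fact p.Prime] {n : ℕ} (V : Set (Fin n → ℚ_[p])) (a : Fin n → ℚ_[p]) :
    Submodule ℚ_[p] (Fin n → ℚ_[p]) where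
  carrier := {v | ∀ g ∈ idealOf V,
    ∑ j, MvPolynomial.eval a (MvPolynomial.pderiv j g) * v j = 0}
  add_mem' := by
    intro v w hv hw g hg
    simp only [Pi.add_apply, mul_add, Finset.sum_add_distrib, hv g hg, hw g hg, add_zero]
  zero_mem' := by
    intro g _
    simp
  smul_mem' := by
    intro c v hv g hg
    simp only [Pi.smul_apply, smul_eq_mul, mul_left_comm _ c, ← Finset.mul_sum, hv g hg, mul_zero]

/-- The dimension of `V` at a point `a ∈ V`: the height of the maximal ideal of `a` in the
coordinate ring `ℚ_p[x_1, …, x_n] / I(V)`, that is the Krull dimension of the local ring. -/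
def localDim {p : ℕ} [Fact p.Prime] {n : ℕ} (V : Set (Fin n → ℚ_[p])) (a : Fin n → ℚ_[p]) : ℕ∞ :=
  ((idealOf {a}).map (Ideal.Quotient.mk (idealOf V))).height

/-- `a` is a smooth point of `V` at which `V` has dimension `d`: the tangent space and the local
ring both have dimension `d`. -/
def IsSmoothPoint {p : ℕ} [Fact p.Prime] {n : ℕ} (V : Set (Fin n → ℚ_[p])) (d : ℕ)
    (a : Fin n → ℚ_[p]) : Prop :=
  a ∈ V ∧ localDim V a = d ∧ Module.finrank ℚ_[p] (tangentSpace V a) = d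

/-- `f_1, …, f_r` are local equations of `V` at `x`: they are elements of `I(V) ∩ ℤ_p[x_1, …, x_n]`
which generate this ideal after localization at the prime of all polynomials vanishing at `x`. -/
def IsLocalEquations {p : ℕ} [Fact p.Prime] {n r : ℕ} (V : Set (Fin n → ℚ_[p]))
    (x : Fin n → ℤ_[p]) (f : Fin r → MvPolynomial (Fin n) ℤ_[p]) : Prop :=
  (∀ i, f i ∈ integralIdealOf V) ∧
    ∀ g ∈ integralIdealOf V, ∃ h : MvPolynomial (Fin n) ℤ_[p],
      MvPolynomial.eval x h ≠ 0 ∧ h * g ∈ Ideal.span (Set.range f)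

/-- The Jacobian matrix of `f` at `x`. -/
def jacobianMatrix {p : ℕ} [Fact p.Prime] {n r : ℕ} (f : Fin r → MvPolynomial (Fin n) ℤ_[p])
    (x : Fin n → ℤ_[p]) : Matrix (Fin r) (Fin n) ℤ_[p] :=
  Matrix.of fun i j => MvPolynomial.eval x (MvPolynomial.pderiv j (f i))

/-- `|J_f(x)|`: the largest absolute value of an `r × r` minor of the Jacobian matrix of
`f = (f_1, …, f_r)` at `x`. -/
def absJacobian {p : ℕ} [Fact p.Prime] {n r : ℕ} (f : Fin r → MvPolynomial (Fin n) ℤ_[p])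
    (x : Fin n → ℤ_[p]) : ℝ :=
  ⨆ e : Fin r ↪o Fin n, ‖((jacobianMatrix f x).submatrix id e).det‖

/-- `N_m(U)`: the number of points of the image of `U ⊆ ℤ_p^n` in `(ℤ/p^m)^n`. -/
def pointCount {p : ℕ} [Fact p.Prime] {n : ℕ} (m : ℕ) (U : Set (Fin n → ℤ_[p])) : ℕ :=
  ((fun (x : Fin n → ℤ_[p]) (i : Fin n) => PadicInt.toZModPow (p := p) m (x i)) '' U).ncard

/-- The closed ball of radius `p^(-ℓ)` around `x` in `ℤ_p^n` (with the maximum norm). -/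
def ball {p : ℕ} [Fact p.Prime] {n : ℕ} (x : Fin n → ℤ_[p]) (ℓ : ℕ) : Set (Fin n → ℤ_[p]) :=
  Metric.closedBall x ((p : ℝ) ^ (-(ℓ : ℤ)))

end

end PadicSet

/-! Near a smooth point `x` the set is parametrized by `ℤ_p^d` in a way that shifts congruences by a
fixed power of `p`, so counting residues reduces to counting `(ℤ/p^m)^d`.

Let `δ` be a maximal minor of the Jacobian matrix of `f` at `x` of largest absolute value.
Smoothness gives `δ ≠ 0`, and `δ` divides all other maximal minors since `ℤ_p` is a valuation ring.
Put `z = x + p^k u` with `δ ∣ p^k`. Multiplying the Taylor expansion by the adjugate of the chosen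
submatrix turns `f(z) = 0` into `B (u + P(u)) = 0`, where `B` contains an identity block and `P`
starts in degree two (`exists_straightening`). By Hensel, `u ↦ u + P(u)` is a bijection of
`(pℤ_p)^n` preserving congruences (`sub_mem_pow_iff`, `exists_add_aeval_eq`), so the zeros of `f` in
the ball of radius `p^(-(k+1))` correspond to the kernel of `B`, which is free of rank `d`.

The `f_i` generate `I(V)` only up to a factor `h` with `h(x) ≠ 0`, and `h` may vanish elsewhere in
the ball. That zeros of `f` still lie in `V` is shown by joining them to `x` by a power series
curve, along which `h` is not identically zero (`eval_eq_zero_of_straightening`).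

Local equations exist by a Jacobian criterion: take elements of `I(V)` whose differentials at `x`
form a basis of all such differentials. Modulo these, the local ring of affine space has maximal
ideal generated by `d` elements, and no proper quotient of such a ring has dimension `d`
(`isDomain_of_maximalIdeal_eq_span`, `exists_notMem_mul_mem_span`).

For compact open `X`, ultrametric balls are nested or disjoint, so `X` is a finite disjoint union of
pieces of the local kind, and their counts add. -/

namespace PadicSet

/-! ### Taylor expansion and Hensel's lemma in adic rings. -/

section

open MvPolynomial

/-- First order Taylor expansion of a polynomial modulo the square of an ideal. -/
theorem aeval_add_sub_mem_sq {A R ι : Type*} [CommRing A] [CommRing R] [Algebra A R] [Fintype ι]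
    (I : Ideal R) (a b : ι → R) (hb : ∀ j, b j ∈ I) (g : MvPolynomial ι A) :
    aeval (a + b) g - aeval a g - ∑ j, aeval a (pderiv j g) * b j ∈ I ^ 2 := by
  classical
  have hlin : ∀ c : ι → R, ∑ j, c j * b j ∈ I := fun c =>
    Ideal.sum_mem _ fun j _ => I.mul_mem_left _ (hb j)
  induction g using MvPolynomial.induction_on with
  | C r => simp
  | add g h hg hh =>
    have := add_mem hg hh
    simp only [map_add, add_mul, Finset.sum_add_distrib]
    convert this using 1
    ring
  | mul_X g i hg =>
    have h1 : ∑ j, aeval a (pderiv j (g * X i)) * b j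
        = a i * (∑ j, aeval a (pderiv j g) * b j) + aeval a g * b i := by
      simp only [pderiv_mul, map_add, map_mul, aeval_X, add_mul, Finset.sum_add_distrib,
        Finset.mul_sum]
      congr 1
      · exact Finset.sum_congr rfl fun j _ => by ring
      · rw [Finset.sum_eq_single i]
        · simp
        · intro j _ hj
          rw [pderiv_X_of_ne hj.symm]
          simp
        · simp
    rw [h1]
    simp only [map_mul, aeval_X, Pi.add_apply]
    have h2 := Ideal.mul_mem_right (a i + b i) _ hg
    have h3 : (∑ j, aeval a (pderiv j g) * b j) * b i ∈ I ^ 2 := by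
      rw [pow_two]; exact Ideal.mul_mem_mul (hlin _) (hb i)
    convert add_mem h2 h3 using 1
    ring

theorem aeval_sub_aeval_mem {A R ι : Type*} [CommRing A] [CommRing R] [Algebra A R]
    (I : Ideal R) (u v : ι → R) (h : ∀ j, u j - v j ∈ I) (g : MvPolynomial ι A) :
    aeval u g - aeval v g ∈ I := by
  induction g using MvPolynomial.induction_on with
  | C r => simp
  | add g h hg hh =>
    convert add_mem hg hh using 1
    simp only [map_add]; ring
  | mul_X g i hg =>
    convert add_mem (I.mul_mem_right (u i) hg) (I.mul_mem_left (aeval v g) (h i)) using 1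
    simp only [map_mul, aeval_X]; ring

theorem aeval_mem_of_mem_idealOfVars {A R ι : Type*} [CommRing A] [CommRing R] [Algebra A R]
    (I : Ideal R) (u : ι → R) (hu : ∀ j, u j ∈ I) {g : MvPolynomial ι A}
    (hg : g ∈ idealOfVars ι A) : aeval u g ∈ I := by
  have : idealOfVars ι A ≤ I.comap (aeval (R := A) u) := by
    rw [idealOfVars, Ideal.span_le]
    rintro _ ⟨j, rfl⟩
    simpa using hu j
  exact this hg

/-- A polynomial without terms of order less than two is contracting on `I^n`. -/
theorem aeval_sub_aeval_mem_pow_succ {A R ι : Type*} [CommRing A] [CommRing R] [Algebra A R]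
    (I : Ideal R) (u v : ι → R) (hu : ∀ j, u j ∈ I) (hv : ∀ j, v j ∈ I) (k : ℕ)
    (h : ∀ j, u j - v j ∈ I ^ k) {g : MvPolynomial ι A}
    (hg : g ∈ idealOfVars ι A ^ 2) : aeval u g - aeval v g ∈ I ^ (k + 1) := by
  rw [pow_two] at hg
  induction hg using Submodule.mul_induction_on' with
  | mem_mul_mem a ha b hb =>
    have h1 := Ideal.mul_mem_mul (aeval_sub_aeval_mem _ u v h a)
      (aeval_mem_of_mem_idealOfVars I u hu hb)
    have h2 := Ideal.mul_mem_mul (aeval_sub_aeval_mem _ u v h b)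
      (aeval_mem_of_mem_idealOfVars I v hv ha)
    rw [pow_succ]
    convert add_mem h1 h2 using 1
    simp only [map_mul]; ring
  | add a _ b _ ha hb =>
    convert add_mem ha hb using 1
    simp only [map_add]; ring

/-- The map `u ↦ u + P(u)` is an isometry of `I^n` if `P` has no terms of order less than two. -/
theorem sub_mem_pow_iff {A R ι : Type*} [CommRing A] [CommRing R] [Algebra A R]
    (I : Ideal R) (P : ι → MvPolynomial ι A) (hP : ∀ j, P j ∈ idealOfVars ι A ^ 2)
    (u v : ι → R) (hu : ∀ j, u j ∈ I) (hv : ∀ j, v j ∈ I) (k : ℕ) :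
    (∀ j, (u j + aeval u (P j)) - (v j + aeval v (P j)) ∈ I ^ k) ↔ ∀ j, u j - v j ∈ I ^ k := by
  constructor
  -- Once `u ≡ v` modulo `I^k`, the values of `P` agree modulo `I^(k+1)`, so the hypothesis modulo
  -- `I^(k+1)` passes to `u - v`.
  · induction k with
    | zero => simp
    | succ k ih =>
      intro h j
      have h1 := ih fun j => Ideal.pow_le_pow_right (Nat.le_succ k) (h j)
      convert sub_mem (h j) (aeval_sub_aeval_mem_pow_succ I u v hu hv k h1 (hP j)) using 1
      ring
  · intro h j
    have h1 := aeval_sub_aeval_mem_pow_succ I u v hu hv k h (hP j)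
    convert add_mem (h j) (Ideal.pow_le_pow_right (Nat.le_succ k) h1) using 1
    ring

/-- An isometry is injective once the powers of `I` meet in zero. This is the uniqueness half of
Hensel's lemma. -/
theorem eq_of_add_aeval_eq {A R ι : Type*} [CommRing A] [CommRing R] [Algebra A R]
    (I : Ideal R) [IsHausdorff I R] (P : ι → MvPolynomial ι A)
    (hP : ∀ j, P j ∈ idealOfVars ι A ^ 2)
    (u v : ι → R) (hu : ∀ j, u j ∈ I) (hv : ∀ j, v j ∈ I)
    (h : ∀ j, u j + aeval u (P j) = v j + aeval v (P j)) : u = v := by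
  funext j
  rw [← sub_eq_zero]
  refine IsHausdorff.haus ‹_› _ fun k => ?_
  rw [SModEq.zero, smul_eq_mul, Ideal.mul_top]
  refine (sub_mem_pow_iff I P hP u v hu hv k).1 (fun j => ?_) j
  rw [h, sub_self]
  exact zero_mem _

/-- Hensel's lemma: the map `u ↦ u + P(u)` is surjective on `I^n` if `P` has no terms of order less
than two and the ring is `I`-adically complete. -/
theorem exists_add_aeval_eq {A R ι : Type*} [CommRing A] [CommRing R] [Algebra A R]
    (I : Ideal R) [IsAdicComplete I R] (P : ι → MvPolynomial ι A)
    (hP : ∀ j, P j ∈ idealOfVars ι A ^ 2) (w : ι → R) (hw : ∀ j, w j ∈ I) :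
    ∃ u : ι → R, (∀ j, u j ∈ I) ∧ ∀ j, u j + aeval u (P j) = w j := by
  have hP1 : ∀ j, P j ∈ idealOfVars ι A := fun j => Ideal.pow_le_self two_ne_zero (hP j)
  -- A solution is a fixed point of the contraction `T`; it is the limit of the iterates of `0`.
  let T : (ι → R) → (ι → R) := fun u j => w j - aeval u (P j)
  let s : ℕ → ι → R := fun k => T^[k] 0
  have hs : ∀ k, s (k + 1) = T (s k) := fun k => Function.iterate_succ_apply' T k 0
  have hsI : ∀ k j, s k j ∈ I := by
    intro k
    induction k with
    | zero => intro j; exact zero_mem _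
    | succ k ih =>
      intro j
      rw [hs]
      exact sub_mem (hw j) (aeval_mem_of_mem_idealOfVars I _ ih (hP1 j))
  have hstep : ∀ k j, s k j - s (k + 1) j ∈ I ^ k := by
    intro k
    induction k with
    | zero => simp
    | succ k ih =>
      intro j
      rw [hs (k + 1), hs k]
      convert neg_mem (aeval_sub_aeval_mem_pow_succ I _ _ (hsI k) (hsI (k + 1)) k ih (hP j))
        using 1
      simp only [T, ← hs k]
      ring
  have hcauchy : ∀ j {m k : ℕ}, m ≤ k → s m j ≡ s k j [SMOD (I ^ m • ⊤ : Submodule R R)] := by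
    intro j m k hmk
    rw [SModEq.sub_mem, smul_eq_mul, Ideal.mul_top]
    induction k, hmk using Nat.le_induction with
    | base => simp
    | succ k hmk ih =>
      convert add_mem ih (Ideal.pow_le_pow_right hmk (hstep k j)) using 1
      ring
  have hlim : ∀ j, ∃ L : R, ∀ m, s m j - L ∈ I ^ m := by
    intro j
    obtain ⟨L, hL⟩ := IsPrecomplete.prec (IsAdicComplete.toIsPrecomplete (I := I) (M := R))
      (f := fun k => s k j) (hcauchy j)
    refine ⟨L, fun m => ?_⟩
    have := hL m
    rwa [SModEq.sub_mem, smul_eq_mul, Ideal.mul_top] at this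
  choose u hu using hlim
  have huI : ∀ j, u j ∈ I := by
    intro j
    have h1 := hu j 1
    rw [pow_one] at h1
    convert sub_mem (hsI 1 j) h1 using 1
    ring
  refine ⟨u, huI, fun j => ?_⟩
  rw [← sub_eq_zero]
  refine IsHausdorff.haus (IsAdicComplete.toIsHausdorff (I := I) (M := R)) _ fun k => ?_
  rw [SModEq.zero, smul_eq_mul, Ideal.mul_top]
  have h1 := aeval_sub_aeval_mem_pow_succ I _ _ (hsI k) huI k (fun j => hu j k) (hP j)
  -- Index `k + 1` matches `P` evaluated at index `k`, because `s (k + 1) = w - P (s k)`.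
  have h2 := hu j (k + 1)
  have h3 : s (k + 1) j = w j - aeval (s k) (P j) := by rw [hs]
  refine Ideal.pow_le_pow_right (Nat.le_succ k) ?_
  convert neg_mem (add_mem h1 h2) using 1
  rw [h3]; ring

end

/-! ### Local rings whose maximal ideal has as few generators as the dimension. -/

section

open IsLocalRing

/-- A Noetherian local ring whose maximal ideal is generated by `d` elements and whose dimension is
at least `d` is a domain. -/
theorem isDomain_of_maximalIdeal_eq_span.{u} (d : ℕ) : ∀ (A : Type u) [CommRing A] [IsLocalRing A]
    [IsNoetherianRing A] (a : Fin d → A), maximalIdeal A = Ideal.span (Set.range a) →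
    (d : WithBot ℕ∞) ≤ ringKrullDim A → IsDomain A := by
  induction d with
  | zero =>
    intro A _ _ _ a ha _
    have h0 : maximalIdeal A = ⊥ := by simpa using ha
    exact (isField_iff_maximalIdeal_eq.2 h0).isDomain
  | succ d ih =>
    intro A _ _ _ a ha hd
    have hfin : (minimalPrimes A).Finite := minimalPrimes.finite_of_isNoetherianRing A
    have hdim0 : ringKrullDim A ≠ 0 := by
      intro h
      rw [h] at hd
      have : ((d + 1 : ℕ) : WithBot ℕ∞) ≤ ((0 : ℕ) : WithBot ℕ∞) := by simpa only [Nat.cast_zero] using hd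
      have := WithBot.coe_le_coe.1 this
      have : d + 1 ≤ 0 := by exact_mod_cast this
      omega
    have hmin : maximalIdeal A ∉ minimalPrimes A := by
      intro h
      apply hdim0
      rw [← maximalIdeal_height_eq_ringKrullDim, Ideal.height_eq_zero_iff.2 h]
      rfl
    have hsq : ¬ maximalIdeal A ≤ maximalIdeal A ^ 2 := by
      intro h
      have h0 : maximalIdeal A = ⊥ := by
        refine Submodule.eq_bot_of_le_smul_of_le_jacobson_bot (maximalIdeal A) (maximalIdeal A)
          (IsNoetherian.noetherian _) ?_ (maximalIdeal_le_jacobson ⊥)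
        rwa [smul_eq_mul, ← pow_two]
      exact hdim0 (ringKrullDim_eq_zero_of_isField (isField_iff_maximalIdeal_eq.2 h0))
    -- Prime avoidance. Being outside `m ^ 2` lets `x` replace a generator of `m`; being outside the
    -- minimal primes is what kills `Q` at the end.
    obtain ⟨x, hxm, hxsq, hxmin⟩ : ∃ x ∈ maximalIdeal A, x ∉ maximalIdeal A ^ 2 ∧
        ∀ Q ∈ minimalPrimes A, x ∉ Q := by
      by_contra! hcon
      have hsub : ((maximalIdeal A : Ideal A) : Set A) ⊆
          ⋃ Q ∈ (↑(insert (maximalIdeal A ^ 2) hfin.toFinset) : Set (Ideal A)), (Q : Set A) := by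
        intro x hx
        simp only [Finset.coe_insert, Set.Finite.coe_toFinset, Set.mem_iUnion]
        by_cases h : x ∈ maximalIdeal A ^ 2
        · exact ⟨_, Set.mem_insert _ _, h⟩
        · obtain ⟨Q, hQ, hxQ⟩ := hcon x hx h
          exact ⟨Q, Set.mem_insert_of_mem _ hQ, hxQ⟩
      classical
      -- Prime avoidance tolerates two ideals that are not prime; `m ^ 2` fills both places.
      obtain ⟨Q, hQ, hle⟩ := (Ideal.subset_union_prime (f := fun I : Ideal A => I)
        (maximalIdeal A ^ 2) (maximalIdeal A ^ 2) (by
          intro Q hQ hne _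
          rw [Finset.mem_insert] at hQ
          exact ((hfin.mem_toFinset.1 (hQ.resolve_left hne)).1).1)).1 hsub
      rw [Finset.mem_insert] at hQ
      rcases hQ with rfl | hQ
      · exact hsq hle
      · have hQ' := hfin.mem_toFinset.1 hQ
        have : Q.IsPrime := hQ'.1.1
        have := le_antisymm hle (le_maximalIdeal this.ne_top)
        exact hmin (this ▸ hQ')
    obtain ⟨c, hc⟩ : ∃ c : Fin (d + 1) → A, ∑ i, c i * a i = x := by
      have : x ∈ Ideal.span (Set.range a) := ha ▸ hxm
      simpa [Ideal.mem_span_range_iff_exists_fun] using this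
    obtain ⟨i, hi⟩ : ∃ i, IsUnit (c i) := by
      by_contra! hcon
      apply hxsq
      rw [← hc, pow_two]
      refine Ideal.sum_mem _ fun i _ => Ideal.mul_mem_mul ((mem_maximalIdeal _).2 (hcon i)) ?_
      rw [ha]
      exact Ideal.subset_span ⟨i, rfl⟩
    have hspan : maximalIdeal A ≤ Ideal.span {x} ⊔ Ideal.span (Set.range (a ∘ i.succAbove)) := by
      have hmem : ∀ j, a (i.succAbove j) ∈ Ideal.span (Set.range (a ∘ i.succAbove)) :=
        fun j => Ideal.subset_span ⟨j, rfl⟩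
      rw [ha, Ideal.span_le]
      rintro _ ⟨k, rfl⟩
      rcases Fin.eq_self_or_eq_succAbove i k with rfl | ⟨j, rfl⟩
      · rw [Fin.sum_univ_succAbove _ k] at hc
        have h1 : c k * a k ∈ Ideal.span {x} ⊔ Ideal.span (Set.range (a ∘ k.succAbove)) := by
          rw [eq_sub_of_add_eq hc]
          refine sub_mem (Ideal.mem_sup_left (Ideal.mem_span_singleton_self x))
            (Ideal.mem_sup_right (Ideal.sum_mem _ fun j _ => Ideal.mul_mem_left _ _ (hmem j)))
        exact (Ideal.unit_mul_mem_iff_mem _ hi).1 h1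
      · exact Ideal.mem_sup_right (hmem j)
    have hne : Ideal.span {x} ≠ ⊤ := fun h => by
      have : Ideal.span {x} ≤ maximalIdeal A := by simpa [Ideal.span_le] using hxm
      exact (Ideal.IsPrime.ne_top inferInstance) (top_le_iff.1 (h ▸ this))
    have : Nontrivial (A ⧸ Ideal.span {x}) := Ideal.Quotient.nontrivial_iff.2 hne
    have hsurj := Ideal.Quotient.mk_surjective (I := Ideal.span {x})
    have : IsLocalRing (A ⧸ Ideal.span {x}) :=
      IsLocalRing.of_surjective' (Ideal.Quotient.mk (Ideal.span {x})) hsurj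
    have hmax : maximalIdeal (A ⧸ Ideal.span {x}) =
        Ideal.span (Set.range (Ideal.Quotient.mk (Ideal.span {x}) ∘ a ∘ i.succAbove)) := by
      apply le_antisymm
      · intro y hy
        obtain ⟨z, rfl⟩ := hsurj y
        have hz : z ∈ maximalIdeal A := fun hu => hy (hu.map _)
        obtain ⟨s, hs, t, ht, rfl⟩ := Submodule.mem_sup.1 (hspan hz)
        rw [map_add, Ideal.Quotient.eq_zero_iff_mem.2 hs, zero_add, Set.range_comp,
          ← Ideal.map_span]
        exact Ideal.mem_map_of_mem _ ht
      · rw [Ideal.span_le]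
        rintro _ ⟨j, rfl⟩
        have : IsLocalHom (Ideal.Quotient.mk (Ideal.span {x})) :=
          IsLocalHom.of_surjective _ hsurj
        have haj : a (i.succAbove j) ∈ maximalIdeal A := ha ▸ Ideal.subset_span ⟨_, rfl⟩
        exact fun hu => haj (isUnit_of_map_unit _ _ hu)
    -- Dividing by one element lowers the dimension by at most one, so the induction hypothesis
    -- applies and `(x)` is prime.
    have hdim : (d : WithBot ℕ∞) ≤ ringKrullDim (A ⧸ Ideal.span {x}) := by
      have h1 := ringKrullDim_le_ringKrullDim_quotient_add_card {x} (R := A) (by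
        simpa [IsLocalRing.ringJacobson_eq_maximalIdeal] using hxm)
      rw [Finset.coe_singleton] at h1
      have h2 := hd.trans h1
      simp only [Finset.card_singleton, Nat.cast_add, Nat.cast_one] at h2
      exact (WithBot.add_le_add_iff_right' (c := (1 : WithBot ℕ∞)) WithBot.one_ne_bot
        (fun h => ENat.one_ne_top (WithBot.coe_injective h))).1 h2
    have hdom := ih (A ⧸ Ideal.span {x}) _ hmax hdim
    have hprime : (Ideal.span {x}).IsPrime := (Ideal.Quotient.isDomain_iff_prime _).1 hdom
    obtain ⟨Q, hQ, hQx⟩ := Ideal.exists_minimalPrimes_le (bot_le : ⊥ ≤ Ideal.span {x})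
    have hQp : Q.IsPrime := hQ.1.1
    -- An element `b * x` of `Q` has `b ∈ Q` because `x ∉ Q`. Hence `Q ⊆ m Q`, and Nakayama applies.
    have hQ0 : Q = ⊥ := by
      refine Submodule.eq_bot_of_le_smul_of_le_jacobson_bot (maximalIdeal A) Q
        (IsNoetherian.noetherian _) ?_ (maximalIdeal_le_jacobson ⊥)
      intro q hq
      obtain ⟨b, rfl⟩ := Ideal.mem_span_singleton'.1 (hQx hq)
      rw [mul_comm]
      exact Ideal.mul_mem_mul hxm ((hQp.mem_or_mem hq).resolve_right (hxmin Q hQ))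
    have := (Ideal.Quotient.isDomain_iff_prime (⊥ : Ideal A)).2 (hQ0 ▸ hQp)
    exact (RingEquiv.quotientBot A).symm.isDomain

/-- In a Noetherian local ring whose maximal ideal is generated by `d` elements, only the zero ideal
has a quotient of dimension at least `d`. -/
theorem eq_bot_of_le_ringKrullDim_quotient {A : Type*} [CommRing A] [IsLocalRing A]
    [IsNoetherianRing A] {d : ℕ} (a : Fin d → A)
    (ha : maximalIdeal A = Ideal.span (Set.range a)) (J : Ideal A)
    (hJ : (d : WithBot ℕ∞) ≤ ringKrullDim (A ⧸ J)) : J = ⊥ := by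
  have hdom : IsDomain A := isDomain_of_maximalIdeal_eq_span d A a ha
    (hJ.trans (ringKrullDim_quotient_le J))
  by_contra hne
  obtain ⟨y, hy, hy0⟩ := Submodule.exists_mem_ne_zero_of_ne_bot hne
  -- In a domain `y` is a nonzerodivisor, so `A ⧸ J`, a quotient of `A ⧸ (y)`, has dimension below
  -- that of `A`, which is at most `d` by Krull's height theorem.
  have h1 := ringKrullDim_quotient_succ_le_of_nonZeroDivisor
    (mem_nonZeroDivisors_of_ne_zero hy0)
  have h2 : ringKrullDim (A ⧸ J) ≤ ringKrullDim (A ⧸ Ideal.span {y}) :=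
    ringKrullDim_le_of_surjective (Ideal.Quotient.factor (by simpa [Ideal.span_le] using hy))
      (Ideal.Quotient.factor_surjective _)
  have h3 : ringKrullDim A ≤ d := by
    rw [← maximalIdeal_height_eq_ringKrullDim]
    have := Ideal.height_le_card_of_mem_minimalPrimes_span (Set.finite_range a)
      (p := maximalIdeal A) (by
        rw [← ha]; simp [Ideal.minimalPrimes_eq_subsingleton_self])
    have hc : (Set.range a).ncard ≤ d := by
      rw [← Set.image_univ]
      exact (Set.ncard_image_le Set.finite_univ).trans (by simp [Set.ncard_univ])
    have h5 : (maximalIdeal A).height ≤ (d : ℕ∞) := this.trans (by exact_mod_cast hc)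
    exact_mod_cast h5
  have h4 : (d : WithBot ℕ∞) + 1 ≤ d :=
    (by gcongr; exact hJ.trans h2 : (d : WithBot ℕ∞) + 1 ≤ _).trans (h1.trans h3)
  have : ((d + 1 : ℕ) : WithBot ℕ∞) ≤ (d : ℕ) := by exact_mod_cast h4
  have : d + 1 ≤ d := by exact_mod_cast this
  omega

end

/-! ### Jacobian criterion: generators of an ideal near a smooth point. -/

section

open MvPolynomial IsLocalRing

/-- The differential of a polynomial at a point. -/
noncomputable def differential {K : Type*} [Field K] {n : ℕ} (a : Fin n → K) :
    MvPolynomial (Fin n) K →ₗ[K] (Fin n → K) where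
  toFun g j := eval a (pderiv j g)
  map_add' g h := by ext j; simp
  map_smul' c g := by ext j; simp [smul_eval]

theorem differential_apply {K : Type*} [Field K] {n : ℕ} (a : Fin n → K)
    (g : MvPolynomial (Fin n) K) (j : Fin n) : differential a g j = eval a (pderiv j g) := rfl

/-- The affine linear form with differential `c` that vanishes at `a`. -/
noncomputable def affineForm {K : Type*} [Field K] {n : ℕ} (a c : Fin n → K) :
    MvPolynomial (Fin n) K := ∑ j, C (c j) * (X j - C (a j))

theorem eval_affineForm {K : Type*} [Field K] {n : ℕ} (a c : Fin n → K) :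
    eval a (affineForm a c) = 0 := by
  simp [affineForm]

theorem differential_affineForm {K : Type*} [Field K] {n : ℕ} (a c : Fin n → K) :
    differential a (affineForm a c) = c := by
  classical
  ext j
  simp [differential_apply, affineForm, pderiv_X, Pi.single_apply]

/-- The Taylor expansion at `a` with increment `X - a` has no constant or linear term left. -/
theorem mem_sq_of_differential_eq_zero {K : Type*} [Field K] {n : ℕ} (a : Fin n → K)
    (g : MvPolynomial (Fin n) K) (hg : eval a g = 0) (hd : differential a g = 0) :
    g ∈ (RingHom.ker (eval a)) ^ 2 := by
  have h := aeval_add_sub_mem_sq (A := K) (RingHom.ker (eval a)) (fun j => C (a j))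
    (fun j => X j - C (a j)) (by intro j; simp [RingHom.mem_ker]) g
  have h1 : ((fun j => C (a j)) + fun j => X j - C (a j) : Fin n → MvPolynomial (Fin n) K) = X := by
    ext1 j; simp
  have h2 : ∀ q : MvPolynomial (Fin n) K, aeval (fun j => (C (a j) : MvPolynomial (Fin n) K)) q
      = C (eval a q) := by
    intro q
    exact aeval_algebraMap_apply (MvPolynomial (Fin n) K) a q
  rw [h1, aeval_X_left_apply, h2, hg] at h
  have h3 : ∀ j, eval a (pderiv j g) = 0 := fun j => congrFun hd j
  simp only [h2, h3, map_zero, zero_mul, Finset.sum_const_zero, sub_zero] at h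
  exact h

/-- The vectors annihilated by independent `r` covectors in `K^n` form a space of dimension
`n - r`. -/
theorem finrank_ker_add_eq {K : Type*} [Field K] {n r : ℕ} (b : Fin r → Fin n → K)
    (hb : LinearIndependent K b) :
    Module.finrank K (LinearMap.ker (Matrix.mulVecLin (Matrix.of b))) + r = n := by
  have h1 := LinearMap.finrank_range_add_finrank_ker (Matrix.mulVecLin (Matrix.of b))
  have h2 : (Matrix.of b).rank = r := by
    have := LinearIndependent.rank_matrix (M := Matrix.of b) hb
    simpa using this
  rw [Matrix.rank] at h2
  rw [h2] at h1
  simp at h1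
  omega

/-- Let `m` be a prime of a Noetherian ring, `I ⊆ m` an ideal such that the local ring of `I` at `m`
has dimension at least `d`. If `m` is generated modulo `m ^ 2` by elements `g_i` of `I` and `d` further
elements, then the `g_i` generate `I` near `m`. -/
theorem exists_notMem_mul_mem_span {P : Type*} [CommRing P] [IsNoetherianRing P] (m : Ideal P)
    [hmp : m.IsPrime] (I : Ideal P) (hI : I ≤ m) {r d : ℕ} (g : Fin r → P) (hgI : ∀ i, g i ∈ I)
    (lin : Fin d → P) (hlin : ∀ k, lin k ∈ m)
    (hcot : m ≤ Ideal.span (Set.range g) ⊔ Ideal.span (Set.range lin) ⊔ m ^ 2)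
    (hd : (m.map (Ideal.Quotient.mk I)).height = d) (q : P) (hq : q ∈ I) :
    ∃ h ∉ m, h * q ∈ Ideal.span (Set.range g) := by
  classical
  obtain ⟨R, _, _, _⟩ : ∃ (R : Type _) (_ : CommRing R) (_ : Algebra P R),
      IsLocalization.AtPrime R m := ⟨Localization.AtPrime m, inferInstance, inferInstance, inferInstance⟩
  have : IsLocalRing R := IsLocalization.AtPrime.isLocalRing R m
  have : IsNoetherianRing R := IsLocalization.isNoetherianRing m.primeCompl R inferInstance
  let ι := algebraMap (P) R
  let gR : Ideal R := (Ideal.span (Set.range g)).map ι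
  have hgIle : Ideal.span (Set.range g) ≤ I := by
    rw [Ideal.span_le]; rintro _ ⟨i, rfl⟩; exact hgI i
  have hmR : m.map ι = maximalIdeal R := IsLocalization.AtPrime.map_eq_maximalIdeal m R
  have hgRm : gR ≤ maximalIdeal R := hmR ▸ Ideal.map_mono (hgIle.trans hI)
  have hgRne : gR ≠ ⊤ := fun h =>
    (Ideal.IsPrime.ne_top (I := maximalIdeal R) inferInstance) (top_le_iff.1 (h ▸ hgRm))
  let A := R ⧸ gR
  have : Nontrivial A := Ideal.Quotient.nontrivial_iff.2 hgRne
  let π : R →+* A := Ideal.Quotient.mk gR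
  have hπ : Function.Surjective π := Ideal.Quotient.mk_surjective
  have : IsLocalRing A := IsLocalRing.of_surjective' π hπ
  have : IsLocalHom π := IsLocalHom.of_surjective _ hπ
  have hmA : maximalIdeal A = (maximalIdeal R).map π := by
    apply le_antisymm
    · intro y hy
      obtain ⟨z, rfl⟩ := hπ y
      exact Ideal.mem_map_of_mem _ (fun hu => hy (hu.map π))
    · rw [Ideal.map_le_iff_le_comap]
      intro z hz hu
      exact hz (isUnit_of_map_unit π _ hu)
  -- Nakayama: in `A` the `g_i` vanish and `m ^ 2` is negligible, so the `d` elements `lin` suffice.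
  have hmA' : maximalIdeal A = Ideal.span (Set.range (π ∘ ι ∘ lin)) := by
    have hlm : Ideal.span (Set.range lin) ≤ m := by
      rw [Ideal.span_le]
      rintro _ ⟨k, rfl⟩
      exact hlin k
    have hrange : Ideal.span (Set.range (π ∘ ι ∘ lin)) =
        ((Ideal.span (Set.range lin)).map ι).map π := by
      rw [Ideal.map_span, Ideal.map_span, ← Set.range_comp, ← Set.range_comp]
    have hg0 : gR.map π = ⊥ := Ideal.map_quotient_self gR
    rw [hrange]
    apply le_antisymm
    · refine Submodule.le_of_le_smul_of_le_jacobson_bot (I := maximalIdeal A)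
        (IsNoetherian.noetherian _) (maximalIdeal_le_jacobson ⊥) ?_
      have h1 := Ideal.map_mono (f := π) (Ideal.map_mono (f := ι) hcot)
      rw [Ideal.map_sup, Ideal.map_sup, Ideal.map_sup, Ideal.map_sup, hmR, ← hmA, hg0, bot_sup_eq,
        Ideal.map_pow, Ideal.map_pow, hmR, ← hmA, pow_two] at h1
      exact h1
    · rw [hmA, ← hmR]
      exact Ideal.map_mono (Ideal.map_mono hlm)
  let IR : Ideal R := I.map ι
  -- `R ⧸ IR` is the localization of `P ⧸ I` at the image of `m`, and localization preserves the
  -- height `d` of that prime.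
  have hdimR : (d : WithBot ℕ∞) ≤ ringKrullDim (R ⧸ IR) := by
    have hpr : (m.map (Ideal.Quotient.mk I)).IsPrime := Ideal.isPrime_map_quotientMk_of_isPrime hI
    have hcomap : (m.map (Ideal.Quotient.mk I)).comap (Ideal.Quotient.mk I) = m := by
      rw [Ideal.comap_map_of_surjective _ Ideal.Quotient.mk_surjective, ← RingHom.ker_eq_comap_bot,
        Ideal.mk_ker, sup_eq_left.2 hI]
    have hdis : Disjoint
        (Algebra.algebraMapSubmonoid (P ⧸ I) m.primeCompl : Set _)
        (m.map (Ideal.Quotient.mk I) : Set (P ⧸ I)) := by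
      rw [Set.disjoint_left]
      rintro _ ⟨s, hs, rfl⟩ hsm
      refine hs ?_
      rw [← hcomap]
      exact hsm
    have h1 := IsLocalization.height_map_of_disjoint (S := R ⧸ IR)
      (Algebra.algebraMapSubmonoid (P ⧸ I) m.primeCompl)
      (m.map (Ideal.Quotient.mk I)) hdis
    have h2 := IsLocalization.isPrime_of_isPrime_disjoint _ (R ⧸ IR) _ hpr hdis
    have h3 := Ideal.height_le_ringKrullDim_of_isPrime (I := Ideal.map (algebraMap
      (P ⧸ I) (R ⧸ IR)) (m.map (Ideal.Quotient.mk I)))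
    rw [h1, hd] at h3
    exact_mod_cast h3
  have hJ : IR.map π = ⊥ := by
    refine eq_bot_of_le_ringKrullDim_quotient _ hmA' (IR.map π) (hdimR.trans ?_)
    have hle : gR ≤ IR := Ideal.map_mono hgIle
    refine ringKrullDim_le_of_surjective
      (Ideal.Quotient.lift (IR.map π) (Ideal.Quotient.factor hle) ?_) ?_
    · intro y hy
      have : IR.map π ≤ RingHom.ker (Ideal.Quotient.factor hle) := by
        rw [Ideal.map_le_iff_le_comap]
        intro z hz
        rw [Ideal.mem_comap, RingHom.mem_ker]
        exact (Ideal.Quotient.factor_mk hle z).trans (Ideal.Quotient.eq_zero_iff_mem.2 hz)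
      exact this hy
    · exact Ideal.Quotient.lift_surjective_of_surjective _ _ (Ideal.Quotient.factor_surjective hle)
  have hqg : ι q ∈ gR := by
    have h1 : π (ι q) ∈ IR.map π := Ideal.mem_map_of_mem _ (Ideal.mem_map_of_mem _ hq)
    rw [hJ, Ideal.mem_bot] at h1
    exact Ideal.Quotient.eq_zero_iff_mem.1 h1
  obtain ⟨h, hh, hhq⟩ := (IsLocalization.algebraMap_mem_map_algebraMap_iff m.primeCompl R _ q).1 hqg
  exact ⟨h, hh, hhq⟩

/-- Let `I` be an ideal of polynomials vanishing at `a` such that the local ring and the tangent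
space of `I` at `a` have dimension `d`. Then `I` is generated by `n - d` elements near `a`. -/
theorem exists_local_generators {K : Type*} [Field K] {n d : ℕ} (a : Fin n → K)
    (I : Ideal (MvPolynomial (Fin n) K)) (hI : I ≤ RingHom.ker (eval a))
    (T : Submodule K (Fin n → K))
    (hT : ∀ v, v ∈ T ↔ ∀ g ∈ I, ∑ j, eval a (pderiv j g) * v j = 0)
    (hTd : Module.finrank K T = d)
    (hd : ((RingHom.ker (eval a)).map (Ideal.Quotient.mk I)).height = d) :
    ∃ (r : ℕ) (g : Fin r → MvPolynomial (Fin n) K), r + d = n ∧ (∀ i, g i ∈ I) ∧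
      ∀ q ∈ I, ∃ h, eval a h ≠ 0 ∧ h * q ∈ Ideal.span (Set.range g) := by
  classical
  set m : Ideal (MvPolynomial (Fin n) K) := RingHom.ker (eval a) with hm
  have hmp : m.IsPrime := RingHom.ker_isPrime _
  -- `W` is the space of differentials at `a` of elements of `I`. The tangent space `T` is its
  -- annihilator, so `W` has dimension `n - d`.
  let W : Submodule K (Fin n → K) := (I.restrictScalars K).map (differential a)
  let r := Module.finrank K W
  let b := Module.finBasis K W
  have hlift : ∀ i, ∃ g ∈ I, differential a g = b i := fun i => by
    obtain ⟨g, hg, h⟩ := (b i).2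
    exact ⟨g, hg, h⟩
  choose g hgI hgb using hlift
  have hTker : T = LinearMap.ker (Matrix.mulVecLin (Matrix.of fun i => (b i : Fin n → K))) := by
    ext v
    rw [hT, LinearMap.mem_ker]
    constructor
    · intro h
      ext i
      have := h (g i) (hgI i)
      simp only [Matrix.mulVecLin_apply, Matrix.mulVec, Matrix.of_apply, dotProduct, Pi.zero_apply]
      rw [← this]
      refine Finset.sum_congr rfl fun j _ => ?_
      rw [← hgb i, differential_apply]
    · intro h q hq
      let φ : (Fin n → K) →ₗ[K] K := ∑ j, v j • LinearMap.proj j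
      have hφ : ∀ w, φ w = ∑ j, w j * v j := fun w => by
        simp [φ, mul_comm]
      have h0 : φ ∘ₗ W.subtype = 0 := b.ext fun i => by
        have := congrFun h i
        simpa [hφ, Matrix.mulVec, dotProduct] using this
      have := LinearMap.congr_fun h0 ⟨differential a q, Submodule.mem_map_of_mem hq⟩
      simpa [hφ, differential_apply] using this
  have hbi : LinearIndependent K (fun i => (b i : Fin n → K)) :=
    b.linearIndependent.map' W.subtype (Submodule.ker_subtype W)
  have hrd : r + d = n := by
    have := finrank_ker_add_eq _ hbi
    rw [← hTker, hTd] at this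
    omega
  -- Affine forms with differentials in a complement of `W` supply the `d` further generators of `m`
  -- modulo `m ^ 2`.
  obtain ⟨W', hW'⟩ := W.exists_isCompl
  have hW'd : Module.finrank K W' = d := by
    have := Submodule.finrank_add_eq_of_isCompl hW'
    simp only [Module.finrank_fin_fun] at this
    omega
  let b' := Module.finBasisOfFinrankEq K W' hW'd
  let lin : Fin d → MvPolynomial (Fin n) K := fun k => affineForm a (b' k)
  refine ⟨r, g, hrd, hgI, ?_⟩
  have hcot : m ≤ Ideal.span (Set.range g) ⊔ Ideal.span (Set.range lin) ⊔ m ^ 2 := by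
    intro q hq
    obtain ⟨w, hw, w', hw', hww⟩ := Submodule.mem_sup.1
      (hW'.sup_eq_top ▸ Submodule.mem_top : differential a q ∈ W ⊔ W')
    have e1 := congrArg W.subtype (b.sum_repr ⟨w, hw⟩)
    have e2 := congrArg W'.subtype (b'.sum_repr ⟨w', hw'⟩)
    simp only [map_sum, map_smul, Submodule.subtype_apply] at e1 e2
    set s1 : MvPolynomial (Fin n) K := ∑ i, (b.repr ⟨w, hw⟩ i) • g i with hs1
    set s2 : MvPolynomial (Fin n) K := ∑ k, (b'.repr ⟨w', hw'⟩ k) • lin k with hs2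
    have hs1m : s1 ∈ Ideal.span (Set.range g) := Ideal.sum_mem _ fun i _ =>
      Submodule.smul_of_tower_mem _ _ (Ideal.subset_span ⟨i, rfl⟩)
    have hs2m : s2 ∈ Ideal.span (Set.range lin) := Ideal.sum_mem _ fun i _ =>
      Submodule.smul_of_tower_mem _ _ (Ideal.subset_span ⟨i, rfl⟩)
    have hev : eval a (q - s1 - s2) = 0 := by
      have h1 : eval a q = 0 := hq
      have h2 : ∀ i, eval a (g i) = 0 := fun i => hI (hgI i)
      simp [h1, hs1, hs2, smul_eval, h2, lin, eval_affineForm]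
    have hdf : differential a (q - s1 - s2) = 0 := by
      rw [map_sub, map_sub, hs1, hs2, map_sum, map_sum]
      simp only [map_smul, hgb, lin, differential_affineForm]
      rw [e1, e2, ← hww]
      abel
    have := mem_sq_of_differential_eq_zero a _ hev hdf
    have h3 : q = (s1 + s2) + (q - s1 - s2) := by ring
    rw [h3]
    exact add_mem (Ideal.mem_sup_left (add_mem (Ideal.mem_sup_left hs1m)
      (Ideal.mem_sup_right hs2m))) (Ideal.mem_sup_right this)
  intro q hq
  obtain ⟨h, hh, hhq⟩ := exists_notMem_mul_mem_span m I hI g hgI lin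
    (fun k => eval_affineForm a _) hcot hd q hq
  exact ⟨h, hh, hhq⟩

end

/-! ### Integral local equations and their Jacobian matrix. -/

section

open MvPolynomial

variable {p : ℕ} [Fact p.Prime] {n : ℕ}

theorem aeval_toRat (x : Fin n → ℤ_[p]) (f : MvPolynomial (Fin n) ℤ_[p]) :
    eval (toRat x) (map (algebraMap ℤ_[p] ℚ_[p]) f) = (eval x f : ℤ_[p]) := by
  have h := aeval_algebraMap_apply ℚ_[p] x f
  rw [eval_map, ← aeval_def]
  exact h

/-- Denominators of polynomials over `ℚ_p` can be cleared. -/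
theorem exists_C_mul_eq_map (g : MvPolynomial (Fin n) ℚ_[p]) :
    ∃ (b : ℤ_[p]) (f : MvPolynomial (Fin n) ℤ_[p]), b ≠ 0 ∧
      map (algebraMap ℤ_[p] ℚ_[p]) (C b) * g = map (algebraMap ℤ_[p] ℚ_[p]) f := by
  induction g using MvPolynomial.induction_on with
  | C r =>
    obtain ⟨x, y, hy, rfl⟩ := IsFractionRing.div_surjective (A := ℤ_[p]) r
    have hy0 := nonZeroDivisors.ne_zero hy
    refine ⟨y, C x, hy0, ?_⟩
    rw [map_C, map_C, ← C_mul, mul_div_cancel₀]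
    simpa using hy0
  | add g h hg hh =>
    obtain ⟨b, f, hb, hf⟩ := hg
    obtain ⟨c, e, hc, he⟩ := hh
    refine ⟨b * c, C c * f + C b * e, mul_ne_zero hb hc, ?_⟩
    simp only [map_mul, map_add, ← hf, ← he]
    ring
  | mul_X g i hg =>
    obtain ⟨b, f, hb, hf⟩ := hg
    refine ⟨b, f * X i, hb, ?_⟩
    rw [map_mul, ← hf, map_X, mul_assoc]

theorem exists_C_mul_eq_map_of_mem_span {r : ℕ} (f : Fin r → MvPolynomial (Fin n) ℤ_[p])
    {g : MvPolynomial (Fin n) ℚ_[p]}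
    (hg : g ∈ Ideal.span (Set.range fun i => map (algebraMap ℤ_[p] ℚ_[p]) (f i))) :
    ∃ (b : ℤ_[p]) (e : MvPolynomial (Fin n) ℤ_[p]), b ≠ 0 ∧ e ∈ Ideal.span (Set.range f) ∧
      map (algebraMap ℤ_[p] ℚ_[p]) (C b) * g = map (algebraMap ℤ_[p] ℚ_[p]) e := by
  induction hg using Submodule.span_induction with
  | mem g hg =>
    obtain ⟨i, rfl⟩ := hg
    exact ⟨1, f i, one_ne_zero, Ideal.subset_span ⟨i, rfl⟩, by simp⟩
  | zero => exact ⟨1, 0, one_ne_zero, zero_mem _, by simp⟩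
  | add g h _ _ hg hh =>
    obtain ⟨b, f', hb, hfm, hf⟩ := hg
    obtain ⟨c, e, hc, hem, he⟩ := hh
    refine ⟨b * c, C c * f' + C b * e, mul_ne_zero hb hc,
      add_mem (Ideal.mul_mem_left _ _ hfm) (Ideal.mul_mem_left _ _ hem), ?_⟩
    simp only [map_mul, map_add, ← hf, ← he]
    ring
  | smul a g _ hg =>
    obtain ⟨b, f', hb, hfm, hf⟩ := hg
    obtain ⟨c, e, hc, he⟩ := exists_C_mul_eq_map a
    refine ⟨b * c, e * f', mul_ne_zero hb hc, Ideal.mul_mem_left _ _ hfm, ?_⟩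
    simp only [map_mul, smul_eq_mul, ← hf, ← he]
    ring

theorem mem_idealOf {V : Set (Fin n → ℚ_[p])} {g : MvPolynomial (Fin n) ℚ_[p]} :
    g ∈ idealOf V ↔ ∀ a ∈ V, eval a g = 0 := Iff.rfl

theorem mem_integralIdealOf {V : Set (Fin n → ℚ_[p])} {f : MvPolynomial (Fin n) ℤ_[p]} :
    f ∈ integralIdealOf V ↔ map (algebraMap ℤ_[p] ℚ_[p]) f ∈ idealOf V := Iff.rfl

theorem map_injective_padicInt :
    Function.Injective (map (σ := Fin n) (algebraMap ℤ_[p] ℚ_[p])) :=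
  map_injective _ (IsFractionRing.injective ℤ_[p] ℚ_[p])

/-- A smooth point has local equations whose number is the codimension. -/
theorem exists_isLocalEquations {d : ℕ} {V : Set (Fin n → ℚ_[p])} {x : Fin n → ℤ_[p]}
    (hx : IsSmoothPoint V d (toRat x)) :
    ∃ (r : ℕ) (f : Fin r → MvPolynomial (Fin n) ℤ_[p]), r + d = n ∧ IsLocalEquations V x f := by
  obtain ⟨hxV, hd, hT⟩ := hx
  have hker : idealOf {toRat x} = RingHom.ker (eval (toRat x)) := by
    ext g; simp [mem_idealOf, RingHom.mem_ker]
  have hle : idealOf V ≤ RingHom.ker (eval (toRat x)) := fun g hg => hg _ hxV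
  rw [localDim, hker] at hd
  obtain ⟨r, g, hr, hgI, hgen⟩ := exists_local_generators (toRat x) (idealOf V) hle
    (tangentSpace V (toRat x)) (fun v => Iff.rfl) hT hd
  choose b f hb hf using fun i => exists_C_mul_eq_map (g i)
  refine ⟨r, f, hr, fun i => ?_, fun q hq => ?_⟩
  · rw [mem_integralIdealOf, ← hf]
    exact Ideal.mul_mem_left _ _ (hgI i)
  · obtain ⟨h, hh, hhq⟩ := hgen _ hq
    have hspan : Ideal.span (Set.range g) ≤
        Ideal.span (Set.range fun i => map (algebraMap ℤ_[p] ℚ_[p]) (f i)) := by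
      rw [Ideal.span_le]
      rintro _ ⟨i, rfl⟩
      have hu : IsUnit (map (σ := Fin n) (algebraMap ℤ_[p] ℚ_[p]) (C (b i))) := by
        rw [map_C]
        exact (IsUnit.mk0 _ (by simpa using hb i)).map C
      refine (Ideal.unit_mul_mem_iff_mem _ hu).1 ?_
      rw [hf]
      exact Ideal.subset_span ⟨i, rfl⟩
    obtain ⟨c, e, hc, hem, he⟩ := exists_C_mul_eq_map_of_mem_span f (hspan hhq)
    obtain ⟨c', h', hc', hh'⟩ := exists_C_mul_eq_map h
    refine ⟨C c * h', ?_, ?_⟩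
    · have h1 : eval (toRat x) (map (algebraMap ℤ_[p] ℚ_[p]) h') ≠ 0 := by
        rw [← hh', map_mul, map_C, eval_C]
        exact mul_ne_zero (by simpa using hc') hh
      rw [aeval_toRat] at h1
      rw [map_mul, eval_C]
      exact mul_ne_zero hc (by simpa using h1)
    · have : C c * h' * q = C c' * e := by
        apply map_injective_padicInt
        simp only [map_mul (map (algebraMap ℤ_[p] ℚ_[p])), ← he, ← hh']
        ring
      rw [this]
      exact Ideal.mul_mem_left _ _ hem

theorem exists_orderEmb_comp_perm {r : ℕ} (φ : Fin r → Fin n) (hφ : Function.Injective φ) :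
    ∃ (e : Fin r ↪o Fin n) (σ : Equiv.Perm (Fin r)), φ = e ∘ σ := by
  classical
  have hc : (Finset.univ.image φ).card = r := by
    rw [Finset.card_image_of_injective _ hφ, Finset.card_fin]
  let e := (Finset.univ.image φ).orderEmbOfFin hc
  have hmem : ∀ i, ∃ k, e k = φ i := fun i => by
    have : φ i ∈ Set.range e := by
      rw [Finset.range_orderEmbOfFin]
      simp
    exact this
  choose τ hτ using hmem
  have hinj : Function.Injective τ := fun i j h => hφ (by rw [← hτ, ← hτ, h])
  exact ⟨e, Equiv.ofBijective τ (Finite.injective_iff_bijective.1 hinj), funext fun i => (hτ i).symm⟩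

/-- A matrix whose rank is the number of its rows has a nonzero maximal minor. -/
theorem exists_det_submatrix_ne_zero {K : Type*} [Field K] {r : ℕ} (J : Matrix (Fin r) (Fin n) K)
    (hJ : J.rank = r) : ∃ e : Fin r ↪o Fin n, (J.submatrix id e).det ≠ 0 := by
  obtain ⟨κ, a, ha, hspan, hli⟩ := exists_linearIndependent' K J.col
  have : Finite κ := Finite.of_injective a ha
  have : Fintype κ := Fintype.ofFinite κ
  have hcard : Fintype.card κ = r := by
    rw [← finrank_span_eq_card hli, hspan, ← Matrix.rank_eq_finrank_span_cols, hJ]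
  let ε : Fin r ≃ κ := (Fintype.equivFinOfCardEq hcard).symm
  obtain ⟨e, σ, he⟩ := exists_orderEmb_comp_perm (a ∘ ε) (ha.comp ε.injective)
  refine ⟨e, ?_⟩
  have hli' : LinearIndependent K (J.submatrix id e).col := by
    have h1 := hli.comp (ε ∘ σ.symm) (ε.injective.comp σ.symm.injective)
    have h2 : (J.submatrix id e).col = (J.col ∘ a) ∘ ε ∘ σ.symm := by
      funext i
      have h3 : e i = a (ε (σ.symm i)) := by simpa using (congrFun he (σ.symm i)).symm
      change J.col (e i) = _
      rw [h3]
      rfl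
    rw [h2]
    exact h1
  have := Matrix.linearIndependent_cols_iff_isUnit.1 hli'
  exact ((Matrix.isUnit_iff_isUnit_det _).1 this).ne_zero

/-- The Jacobian matrix of local equations at a smooth point has a nonzero maximal minor. -/
theorem exists_minor_ne_zero {r d : ℕ} {V : Set (Fin n → ℚ_[p])} {x : Fin n → ℤ_[p]}
    (hx : IsSmoothPoint V d (toRat x)) (hr : r + d = n)
    {f : Fin r → MvPolynomial (Fin n) ℤ_[p]} (hf : IsLocalEquations V x f) :
    ∃ e : Fin r ↪o Fin n, ((jacobianMatrix f x).submatrix id e).det ≠ 0 := by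
  obtain ⟨hxV, -, hT⟩ := hx
  set J := (jacobianMatrix f x).map (algebraMap ℤ_[p] ℚ_[p]) with hJ
  have hJij : ∀ i j, J i j
      = eval (toRat x) (pderiv j (map (algebraMap ℤ_[p] ℚ_[p]) (f i))) := by
    intro i j
    rw [pderiv_map, aeval_toRat]
    rfl
  have hfx : ∀ g ∈ integralIdealOf V, eval x g = 0 := by
    intro g hg
    have h : eval (toRat x) (map (algebraMap ℤ_[p] ℚ_[p]) g) = 0 := hg _ hxV
    rw [aeval_toRat] at h
    simpa using h
  have hker : tangentSpace V (toRat x) = LinearMap.ker J.mulVecLin := by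
    ext v
    rw [LinearMap.mem_ker]
    constructor
    · intro h
      ext i
      have := h _ (hf.1 i)
      simpa [Matrix.mulVec, dotProduct, hJij] using this
    · intro h
      have hv : ∀ i, ∑ j, eval (toRat x) (pderiv j (map (algebraMap ℤ_[p] ℚ_[p]) (f i))) * v j
          = 0 := fun i => by
        have := congrFun h i
        simpa [Matrix.mulVec, dotProduct, hJij] using this
      -- Since the `f i` vanish at `x`, the product rule makes the differential of a combination of
      -- them the same combination of their differentials.
      have hspan : ∀ q ∈ Ideal.span (Set.range f),
          ∑ j, eval (toRat x) (pderiv j (map (algebraMap ℤ_[p] ℚ_[p]) q)) * v j = 0 := by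
        intro q hq
        obtain ⟨c, rfl⟩ := Ideal.mem_span_range_iff_exists_fun.1 hq
        have h0 : ∀ i, eval (toRat x) (map (algebraMap ℤ_[p] ℚ_[p]) (f i)) = 0 := fun i => by
          rw [aeval_toRat, hfx _ (hf.1 i)]; simp
        simp only [map_sum, map_mul, pderiv_mul, map_add, h0, mul_zero, zero_add,
          Finset.sum_mul]
        rw [Finset.sum_comm]
        refine Finset.sum_eq_zero fun i _ => ?_
        simp only [mul_assoc]
        rw [← Finset.mul_sum, hv, mul_zero]
      intro g hg
      obtain ⟨b, g', hb, hg'⟩ := exists_C_mul_eq_map g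
      have hg'I : g' ∈ integralIdealOf V := by
        rw [mem_integralIdealOf, ← hg']
        exact Ideal.mul_mem_left _ _ hg
      obtain ⟨h', hh', hmem⟩ := hf.2 g' hg'I
      have h1 := hspan _ hmem
      rw [map_mul, ← hg'] at h1
      have h2 : eval (toRat x) g = 0 := hg _ hxV
      simp only [pderiv_mul, map_mul, map_add, h2, map_C, pderiv_C, eval_C, mul_zero, zero_mul,
        zero_add, aeval_toRat] at h1
      -- Since `g` vanishes at `x`, the differential of `h' * b * g` there is `h'(x) * b` times that
      -- of `g`; this nonzero factor can be cancelled.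
      have h3 : ((eval x h' : ℤ_[p]) : ℚ_[p]) * (b : ℚ_[p]) ≠ 0 :=
        mul_ne_zero (by simpa using hh') (by simpa using hb)
      refine (mul_eq_zero.1 ?_).resolve_left h3
      rw [← h1, Finset.mul_sum]
      refine Finset.sum_congr rfl fun j _ => ?_
      rw [PadicInt.algebraMap_apply]
      ring
  have hrank : J.rank = r := by
    have h1 := LinearMap.finrank_range_add_finrank_ker J.mulVecLin
    rw [← hker, hT] at h1
    simp only [Module.finrank_fin_fun] at h1
    rw [Matrix.rank]
    omega
  obtain ⟨e, he⟩ := exists_det_submatrix_ne_zero J hrank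
  refine ⟨e, fun h => he ?_⟩
  have : J.submatrix id e =
      (algebraMap ℤ_[p] ℚ_[p]).mapMatrix ((jacobianMatrix f x).submatrix id e) := rfl
  rw [this, ← RingHom.map_det, h, map_zero]

end

/-! ### Straightening the equations by Cramer's rule. -/

section

open MvPolynomial

variable {p : ℕ} [Fact p.Prime] {n : ℕ}

/-- The quotient `a / b` has norm at most one, so it is integral. This makes the minor of largest
norm a divisor of all the others. -/
theorem dvd_of_norm_le {a b : ℤ_[p]} (h : ‖a‖ ≤ ‖b‖) : b ∣ a := by
  by_cases hb : b = 0
  · subst hb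
    rw [norm_zero, norm_le_zero_iff] at h
    exact h ▸ dvd_rfl
  · have hb' : (b : ℚ_[p]) ≠ 0 := by simpa using hb
    refine ⟨⟨(a : ℚ_[p]) / b, ?_⟩, ?_⟩
    · rw [norm_div]
      exact div_le_one_of_le₀ h (norm_nonneg _)
    · apply PadicInt.ext
      exact (PadicInt.coe_mul _ _).trans (mul_div_cancel₀ _ hb') |>.symm

/-- Cramer's rule: if the minor `e` divides all other maximal minors of `J`, then `J` is the product
of its square submatrix `e` and a matrix that is the identity on the columns `e`. -/
theorem exists_adjugate_mul_eq_smul {A : Type*} [CommRing A] [IsDomain A] {r : ℕ}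
    (J : Matrix (Fin r) (Fin n) A) (e : Fin r → Fin n) (he : (J.submatrix id e).det ≠ 0)
    (hdvd : ∀ φ : Fin r → Fin n, (J.submatrix id e).det ∣ (J.submatrix id φ).det) :
    ∃ B : Matrix (Fin r) (Fin n) A, (∀ i k, B i (e k) = (1 : Matrix (Fin r) (Fin r) A) i k) ∧
      (J.submatrix id e).adjugate * J = (J.submatrix id e).det • B := by
  classical
  set M := J.submatrix id e with hM
  -- By Cramer, the entry is the minor with column `e i` replaced by column `j`. The new column
  -- choice need not be monotone or injective, so divisibility is needed for every `φ`.
  have hent : ∀ i j, (M.adjugate * J) i j = (J.submatrix id (Function.update e i j)).det := by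
    intro i j
    have h1 : (M.adjugate * J) i j = M.cramer (J.col j) i := by
      rw [Matrix.cramer_eq_adjugate_mulVec]; rfl
    rw [h1, Matrix.cramer_apply]
    congr 1
    ext a b
    by_cases h : b = i
    · subst h; simp
    · simp [h, hM]
  choose B hB using fun i j => hdvd (Function.update e i j)
  refine ⟨Matrix.of B, fun i k => ?_, ?_⟩
  · apply mul_left_cancel₀ he
    rw [Matrix.of_apply, ← hB, ← hent]
    have h1 := congrFun (congrFun (Matrix.adjugate_mul M) i) k
    rw [Matrix.smul_apply, smul_eq_mul] at h1
    rw [← h1]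
    rfl
  · ext i j
    rw [hent, hB]
    rfl

/-- Taylor expansion of `f(x + c X)`. -/
theorem exists_taylor {A ι : Type*} [CommRing A] [Fintype ι] (x : ι → A) (c : A)
    (f : MvPolynomial ι A) :
    ∃ q ∈ idealOfVars ι A ^ 2, aeval (fun j => C (x j) + C c * X j) f =
      C (eval x f) + C c * ∑ j, C (eval x (pderiv j f)) * X j + C (c ^ 2) * q := by
  have h := aeval_add_sub_mem_sq (A := A) (Ideal.span {C c} * idealOfVars ι A) (fun j => C (x j))
    (fun j => C c * X j) (fun j => Ideal.mul_mem_mul (Ideal.mem_span_singleton_self _)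
      (Ideal.subset_span ⟨j, rfl⟩)) f
  rw [mul_pow, Ideal.span_singleton_pow, Ideal.mem_span_singleton_mul] at h
  obtain ⟨q, hq, h⟩ := h
  have h2 : ∀ q : MvPolynomial ι A, aeval (fun j => (C (x j) : MvPolynomial ι A)) q
      = C (eval x q) := fun q => aeval_algebraMap_apply (MvPolynomial ι A) x q
  have h3 : ((fun j => C (x j)) + fun j => C c * X j : ι → MvPolynomial ι A)
    = fun j => C (x j) + C c * X j := rfl
  have h4 : ∑ j, C (eval x (pderiv j f)) * (C c * X j : MvPolynomial ι A)
      = C c * ∑ j, C (eval x (pderiv j f)) * X j := by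
    rw [Finset.mul_sum]
    exact Finset.sum_congr rfl fun j _ => by ring
  simp only [h2] at h
  rw [h3, h4, ← C_pow] at h
  exact ⟨q, hq, by rw [h]; abel⟩

/-- After a rescaling, the equations `f = 0` near a zero `x` of `f` with Jacobian matrix `J` become
linear equations `B (u + P(u)) = 0`, where `P` has no terms of order less than two. -/
theorem exists_straightening {A : Type} [CommRing A] [IsDomain A] {r : ℕ} (x : Fin n → A)
    (f : Fin r → MvPolynomial (Fin n) A) (hfx : ∀ k, eval x (f k) = 0)
    (J : Matrix (Fin r) (Fin n) A) (hJ : ∀ k j, J k j = eval x (pderiv j (f k)))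
    (e : Fin r ↪ Fin n) (he : (J.submatrix id e).det ≠ 0)
    (hdvd : ∀ φ : Fin r → Fin n, (J.submatrix id e).det ∣ (J.submatrix id φ).det)
    (c : A) (hc0 : c ≠ 0) (hc : (J.submatrix id e).det ∣ c) :
    ∃ (B : Matrix (Fin r) (Fin n) A) (P : Fin n → MvPolynomial (Fin n) A),
      (∀ i k, B i (e k) = (1 : Matrix (Fin r) (Fin r) A) i k) ∧
      (∀ j, P j ∈ idealOfVars (Fin n) A ^ 2) ∧
      ∀ (R : Type) [CommRing R] [IsDomain R] [Algebra A R],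
        Function.Injective (algebraMap A R) → ∀ u : Fin n → R,
        (∀ k, aeval (fun j => algebraMap A R (x j) + algebraMap A R c * u j) (f k) = 0) ↔
          ∀ i, ∑ j, algebraMap A R (B i j) * (u j + aeval u (P j)) = 0 := by
  classical
  obtain ⟨B, hB1, hB⟩ := exists_adjugate_mul_eq_smul J e he hdvd
  set M := J.submatrix id e with hM
  obtain ⟨c', hc'⟩ := hc
  choose q hq hqf using fun k => exists_taylor x c (f k)
  let q' : Fin r → MvPolynomial (Fin n) A := fun i => ∑ k, C (M.adjugate i k) * q k
  have hq' : ∀ i, q' i ∈ idealOfVars (Fin n) A ^ 2 := fun i =>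
    Ideal.sum_mem _ fun k _ => Ideal.mul_mem_left _ _ (hq k)
  -- Placing the quadratic terms in the coordinates `e i` alone, where `B` is the identity, gives `B
  -- P = c' q'`.
  let P : Fin n → MvPolynomial (Fin n) A := fun j => ∑ i, if e i = j then C c' * q' i else 0
  have hPe : ∀ i, ∑ j, C (B i j) * P j = C c' * q' i := by
    intro i
    simp only [P, Finset.mul_sum]
    rw [Finset.sum_comm]
    simp only [mul_ite, mul_zero, Finset.sum_ite_eq, Finset.mem_univ, if_true, hB1,
      Matrix.one_apply]
    simp [ite_mul, Finset.sum_ite_eq, apply_ite C]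
  refine ⟨B, P, hB1, fun j => Ideal.sum_mem _ fun i _ => ?_, ?_⟩
  · split_ifs
    · exact Ideal.mul_mem_left _ _ (hq' i)
    · exact zero_mem _
  have hpoly : ∀ i, ∑ k, C (M.adjugate i k) * aeval (fun j => C (x j) + C c * X j) (f k) =
      C (c * M.det) * ∑ j, C (B i j) * (X j + P j) := by
    intro i
    have h1 : ∑ k, C (M.adjugate i k) * ∑ j, C (J k j) * X j
        = C M.det * ∑ j, C (B i j) * (X j : MvPolynomial (Fin n) A) := by
      simp only [Finset.mul_sum]
      rw [Finset.sum_comm]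
      refine Finset.sum_congr rfl fun j _ => ?_
      have h2 := congrFun (congrFun hB i) j
      rw [Matrix.smul_apply, smul_eq_mul, Matrix.mul_apply] at h2
      rw [← mul_assoc, ← C_mul, ← h2, map_sum, Finset.sum_mul]
      exact Finset.sum_congr rfl fun k _ => by rw [C_mul, mul_assoc]
    simp only [hqf, hfx, ← hJ, map_zero, zero_add, mul_add, Finset.sum_add_distrib, hPe]
    have h3 : ∑ k, C (M.adjugate i k) * (C c * ∑ j, C (J k j) * X j)
        = C c * ∑ k, C (M.adjugate i k) * ∑ j, C (J k j) * (X j : MvPolynomial (Fin n) A) := by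
      rw [Finset.mul_sum]
      exact Finset.sum_congr rfl fun k _ => by ring
    have h4 : ∑ k, C (M.adjugate i k) * (C (c ^ 2) * q k) = C (c ^ 2) * q' i := by
      rw [Finset.mul_sum]
      exact Finset.sum_congr rfl fun k _ => by ring
    -- Here `det M ∣ c` is used: the quadratic term shares the factor `c * det M` of the linear
    -- term, which can then be cancelled.
    have h5 : (C (c ^ 2) : MvPolynomial (Fin n) A) = C (c * M.det) * C c' := by
      rw [← C_mul, mul_assoc, ← hc', pow_two]
    rw [h3, h1, h4, h5, C_mul]
    ring
  -- `B` and `P` are fixed before `R`, so they serve both for points over `ℤ_p` and for curves over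
  -- `ℤ_p⟦X⟧`.
  intro R _ _ _ hinj u
  have hcomp : ∀ k, aeval (fun j => algebraMap A R (x j) + algebraMap A R c * u j) (f k) =
      aeval u (aeval (fun j => C (x j) + C c * X j : Fin n → MvPolynomial (Fin n) A) (f k)) := by
    intro k
    rw [← AlgHom.comp_apply, comp_aeval]
    congr 2
    funext j
    simp
  have hev : ∀ i, ∑ k, algebraMap A R (M.adjugate i k) *
      aeval (fun j => algebraMap A R (x j) + algebraMap A R c * u j) (f k) =
      algebraMap A R (c * M.det) * ∑ j, algebraMap A R (B i j) * (u j + aeval u (P j)) := by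
    intro i
    have := congrArg (aeval u) (hpoly i)
    simpa only [map_sum, map_mul, map_add, aeval_C, aeval_X, ← hcomp] using this
  have hne : algebraMap A R (c * M.det) ≠ 0 := by
    rw [map_ne_zero_iff _ hinj]
    exact mul_ne_zero hc0 he
  constructor
  · intro h i
    have h1 := hev i
    simp only [h, mul_zero, Finset.sum_const_zero] at h1
    exact (mul_eq_zero.1 h1.symm).resolve_left hne
  · intro h
    set y : Fin r → R := fun k =>
      aeval (fun j => algebraMap A R (x j) + algebraMap A R c * u j) (f k) with hy
    have h1 : ((algebraMap A R).mapMatrix M.adjugate).mulVec y = 0 := by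
      ext i
      have h2 := hev i
      rw [h i, mul_zero] at h2
      exact h2
    -- Multiplying by `M` undoes the adjugate up to the nonzero factor `det M`.
    have h3 : ((algebraMap A R).mapMatrix M * (algebraMap A R).mapMatrix M.adjugate).mulVec y
        = 0 := by
      rw [← Matrix.mulVec_mulVec, h1, Matrix.mulVec_zero]
    rw [← map_mul, Matrix.mul_adjugate] at h3
    intro k
    have h4 := congrFun h3 k
    have h5 : (algebraMap A R).mapMatrix (M.det • (1 : Matrix (Fin r) (Fin r) A))
        = algebraMap A R M.det • 1 := by
      ext a b
      simp [Matrix.one_apply, apply_ite (algebraMap A R)]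
    rw [h5, Matrix.smul_mulVec, Matrix.one_mulVec, Pi.smul_apply, smul_eq_mul, Pi.zero_apply] at h4
    refine (mul_eq_zero.1 h4).resolve_left ?_
    rw [map_eq_zero_iff _ hinj]
    exact he

end

/-! ### Counting residues, and evaluating power series at `p`. -/

section

open MvPolynomial

variable {p : ℕ} [Fact p.Prime] {n : ℕ}

theorem toZModPow_eq_iff (m : ℕ) (a b : ℤ_[p]) :
    PadicInt.toZModPow m a = PadicInt.toZModPow m b ↔ (p : ℤ_[p]) ^ m ∣ a - b := by
  rw [← sub_eq_zero, ← map_sub, ← RingHom.mem_ker, PadicInt.ker_toZModPow,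
    Ideal.mem_span_singleton]

theorem mem_ball_iff {x z : Fin n → ℤ_[p]} {ℓ : ℕ} :
    z ∈ ball x ℓ ↔ ∀ j, (p : ℤ_[p]) ^ ℓ ∣ z j - x j := by
  have hp : (0 : ℝ) ≤ (p : ℝ) ^ (-(ℓ : ℤ)) := by positivity
  rw [ball, Metric.mem_closedBall, dist_pi_le_iff hp]
  refine forall_congr' fun j => ?_
  rw [dist_eq_norm, PadicInt.norm_le_pow_iff_mem_span_pow, Ideal.mem_span_singleton]

/-- The image modulo `p^M` of a subset of `ℤ_p^n` that is parametrized by `ℤ_p^κ` so that congruence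
modulo `p^M` corresponds to congruence modulo `p^m`. -/
theorem pointCount_range {κ : Type*} [Fintype κ] (m M : ℕ) (φ : (κ → ℤ_[p]) → Fin n → ℤ_[p])
    (hφ : ∀ s s', (∀ j, (p : ℤ_[p]) ^ M ∣ φ s j - φ s' j) ↔
      ∀ j, (p : ℤ_[p]) ^ m ∣ s j - s' j) :
    pointCount M (Set.range φ) = p ^ (m * Fintype.card κ) := by
  classical
  have hp : p ≠ 0 := (Fact.out : p.Prime).ne_zero
  -- `σ` is a mere set-theoretic section of reduction modulo `p^m`.
  choose σ hσ using ZMod.ringHom_surjective (PadicInt.toZModPow (p := p) m)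
  let G : (κ → ZMod (p ^ m)) → Fin n → ZMod (p ^ M) :=
    fun t i => PadicInt.toZModPow M (φ (fun j => σ (t j)) i)
  have hG : Function.Injective G := by
    intro t t' h
    have h1 := (hφ (fun j => σ (t j)) (fun j => σ (t' j))).1 fun j =>
      (toZModPow_eq_iff M _ _).1 (congrFun h j)
    funext j
    have h2 := (toZModPow_eq_iff m _ _).2 (h1 j)
    rwa [hσ, hσ] at h2
  have himg : (fun (x : Fin n → ℤ_[p]) (i : Fin n) => PadicInt.toZModPow (p := p) M (x i)) ''
      Set.range φ = G '' Set.univ := by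
    ext y
    constructor
    · rintro ⟨_, ⟨s, rfl⟩, rfl⟩
      refine ⟨fun j => PadicInt.toZModPow m (s j), trivial, ?_⟩
      funext i
      refine (toZModPow_eq_iff M _ _).2 ((hφ _ _).2 (fun j => ?_) i)
      rw [← toZModPow_eq_iff, hσ]
    · rintro ⟨t, -, rfl⟩
      exact ⟨_, ⟨_, rfl⟩, rfl⟩
  rw [pointCount, himg, Set.ncard_image_of_injective _ hG, Set.ncard_univ, Nat.card_fun,
    Nat.card_zmod, Nat.card_eq_fintype_card, ← pow_mul]

/-- The ideals `(p^k)` are the closed balls around zero. Linearity of the topology is needed by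
`PowerSeries.aeval`. -/
instance isLinearTopology_padicInt : IsLinearTopology ℤ_[p] ℤ_[p] := by
  have hp : 1 < (p : ℝ) := by exact_mod_cast (Fact.out : p.Prime).one_lt
  have hb := Metric.nhds_basis_closedBall_pow (x := (0 : ℤ_[p])) (r := (p : ℝ)⁻¹)
    (by positivity) (inv_lt_one_of_one_lt₀ hp)
  refine IsLinearTopology.mk_of_hasBasis' ℤ_[p]
    (s := fun k : ℕ => (Ideal.span {(p : ℤ_[p]) ^ k} : Ideal ℤ_[p])) (p := fun _ => True) ?_ ?_
  · convert hb using 2 with k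
    ext z
    rw [SetLike.mem_coe, ← PadicInt.norm_le_pow_iff_mem_span_pow, mem_closedBall_zero_iff,
      zpow_neg, zpow_natCast, inv_pow]
  · intro I r m hm
    exact I.mul_mem_left r hm

/-- Evaluation of a power series over `ℤ_p` at `p`. -/
theorem exists_evalAtP : ∃ ε : PowerSeries ℤ_[p] →ₐ[ℤ_[p]] ℤ_[p], ε PowerSeries.X = p := by
  have hp : PowerSeries.HasEval (p : ℤ_[p]) := by
    refine tendsto_pow_atTop_nhds_zero_of_norm_lt_one ?_
    rw [PadicInt.norm_p]
    exact inv_lt_one_of_one_lt₀ (by exact_mod_cast (Fact.out : p.Prime).one_lt)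
  refine ⟨PowerSeries.aeval hp, ?_⟩
  have := PowerSeries.aeval_coe hp (Polynomial.X : Polynomial ℤ_[p])
  rwa [Polynomial.coe_X, Polynomial.aeval_X] at this

end

/-! ### Parametrization of the algebraic set in a ball. -/

section

open MvPolynomial

variable {p : ℕ} [Fact p.Prime] {n : ℕ}

theorem aeval_eval_apply {A R S : Type*} [CommRing A] [CommRing R] [CommRing S] [Algebra A R]
    [Algebra A S] {ι : Type*} (ε : R →ₐ[A] S) (u : ι → R) (f : MvPolynomial ι A) :
    ε (aeval u f) = aeval (fun j => ε (u j)) f := by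
  rw [← AlgHom.comp_apply, comp_aeval]

theorem isAdicComplete_span_p : IsAdicComplete (Ideal.span {(p : ℤ_[p])}) ℤ_[p] := by
  rw [← PadicInt.maximalIdeal_eq_span_p]
  infer_instance

/-- A polynomial that vanishes near `x` on the zero set of straightened equations vanishes on all of
the polydisc where the equations are straightened. -/
theorem eval_eq_zero_of_straightening {r : ℕ} (x : Fin n → ℤ_[p]) (c : ℤ_[p])
    (f : Fin r → MvPolynomial (Fin n) ℤ_[p]) (B : Matrix (Fin r) (Fin n) ℤ_[p])
    (P : Fin n → MvPolynomial (Fin n) ℤ_[p]) (hP : ∀ j, P j ∈ idealOfVars (Fin n) ℤ_[p] ^ 2)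
    (hBP : ∀ (R : Type) [CommRing R] [IsDomain R] [Algebra ℤ_[p] R],
        Function.Injective (algebraMap ℤ_[p] R) → ∀ u : Fin n → R,
        (∀ k, aeval (fun j => algebraMap ℤ_[p] R (x j) + algebraMap ℤ_[p] R c * u j) (f k) = 0) ↔
          ∀ i, ∑ j, algebraMap ℤ_[p] R (B i j) * (u j + aeval u (P j)) = 0)
    (g h : MvPolynomial (Fin n) ℤ_[p]) (hx : eval x h ≠ 0)
    (hgh : h * g ∈ Ideal.span (Set.range f))
    (u : Fin n → ℤ_[p]) (hu : ∀ j, u j ∈ Ideal.span {(p : ℤ_[p])})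
    (hBu : ∀ i, ∑ j, B i j * (u j + aeval u (P j)) = 0) :
    eval (fun j => x j + c * u j) g = 0 := by
  have hcomplete : IsAdicComplete (Ideal.span {(p : ℤ_[p])}) ℤ_[p] := isAdicComplete_span_p
  have hp0 : (p : ℤ_[p]) ≠ 0 := PadicInt.prime_p.ne_zero
  obtain ⟨ε, hε⟩ := exists_evalAtP (p := p)
  have hP1 : ∀ j, P j ∈ idealOfVars (Fin n) ℤ_[p] := fun j =>
    Ideal.pow_le_self two_ne_zero (hP j)
  have hw : ∀ j, ∃ w, u j + aeval u (P j) = p * w := fun j => by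
    have := add_mem (hu j) (aeval_mem_of_mem_idealOfVars _ u hu (hP1 j))
    exact Ideal.mem_span_singleton.1 this
  choose w hw using hw
  have hBw : ∀ i, ∑ j, B i j * w j = 0 := fun i => by
    have h1 := hBu i
    simp only [hw, mul_left_comm _ (p : ℤ_[p]), ← Finset.mul_sum] at h1
    exact (mul_eq_zero.1 h1).resolve_left hp0
  let alg := algebraMap ℤ_[p] (PowerSeries ℤ_[p])
  have hinj : Function.Injective alg := fun a b hab => PowerSeries.C_injective hab
  -- Solving `U + P(U) = X w` gives a curve `Y = x + c U` inside `f = 0`, through `x` at `X = 0` and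
  -- through the given point at `X = p`.
  obtain ⟨U, hUI, hU⟩ := exists_add_aeval_eq (A := ℤ_[p])
    (Ideal.span {(PowerSeries.X : PowerSeries ℤ_[p])}) P hP
    (fun j => PowerSeries.X * alg (w j))
    (fun j => Ideal.mul_mem_right _ _ (Ideal.mem_span_singleton_self _))
  have hfU := (hBP (PowerSeries ℤ_[p]) hinj U).2 fun i => by
    simp only [hU, mul_left_comm _ (PowerSeries.X : PowerSeries ℤ_[p]), ← Finset.mul_sum]
    simp only [alg, ← map_mul, ← map_sum, hBw, map_zero, mul_zero]
  set Y : Fin n → PowerSeries ℤ_[p] := fun j => alg (x j) + alg c * U j with hY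
  have hspan : Ideal.span (Set.range f) ≤ RingHom.ker (aeval (R := ℤ_[p]) Y) := by
    rw [Ideal.span_le]
    rintro _ ⟨k, rfl⟩
    exact hfU k
  have hzero : aeval Y h * aeval Y g = 0 := by
    rw [← map_mul]
    exact hspan hgh
  -- The constant term of `h(Y)` is `h(x) ≠ 0`. As `ℤ_p⟦X⟧` is a domain, `g(Y) = 0` even if `h`
  -- vanishes at the endpoint.
  have hh : aeval Y h ≠ 0 := by
    intro h0
    apply hx
    have h1 := aeval_sub_aeval_mem (A := ℤ_[p]) (Ideal.span {(PowerSeries.X : PowerSeries ℤ_[p])})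
      Y (fun j => alg (x j)) (fun j => by
        simp only [hY, add_sub_cancel_left]
        exact Ideal.mul_mem_left _ _ (hUI j)) h
    have h2 : aeval (fun j => alg (x j)) h = alg (eval x h) :=
      aeval_algebraMap_apply (PowerSeries ℤ_[p]) x h
    rw [h0, h2, zero_sub, neg_mem_iff, Ideal.mem_span_singleton, PowerSeries.X_dvd_iff] at h1
    exact h1
  have hg := congrArg ε ((mul_eq_zero.1 hzero).resolve_left hh)
  rw [aeval_eval_apply, map_zero] at hg
  -- Both sides solve `v + P(v) = p w` in `pℤ_p`, so uniqueness in Hensel's lemma identifies them.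
  have hεU : (fun j => ε (U j)) = u := by
    refine eq_of_add_aeval_eq (A := ℤ_[p]) (Ideal.span {(p : ℤ_[p])}) P hP _ _ (fun j => ?_) hu
      fun j => ?_
    · obtain ⟨t, ht⟩ := Ideal.mem_span_singleton.1 (hUI j)
      rw [ht, map_mul, hε]
      exact Ideal.mul_mem_right _ _ (Ideal.mem_span_singleton_self _)
    · have := congrArg ε (hU j)
      rw [map_add, aeval_eval_apply, map_mul, hε] at this
      rw [this, hw]
      congr 1
      exact ε.commutes (w j)
  have hεY : (fun j => ε (Y j)) = fun j => x j + c * u j := by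
    funext j
    rw [hY, ← hεU]
    simp only [map_add, map_mul]
    congr 1
    · exact ε.commutes (x j)
    · congr 1
      exact ε.commutes c
  rw [hεY] at hg
  exact hg

/-- An algebraic set is cut out by `I(V)`, and clearing denominators makes the integral polynomials
in it suffice. -/
theorem mem_integralPoints_iff {V : Set (Fin n → ℚ_[p])} (hV : IsAlgebraic V)
    (z : Fin n → ℤ_[p]) : z ∈ integralPoints V ↔ ∀ g ∈ integralIdealOf V, eval z g = 0 := by
  constructor
  · intro hz g hg
    have h : eval (toRat z) (map (algebraMap ℤ_[p] ℚ_[p]) g) = 0 := hg _ hz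
    rw [aeval_toRat] at h
    simpa using h
  · intro h
    obtain ⟨I, rfl⟩ := hV
    intro g hg
    obtain ⟨b, g', hb, hg'⟩ := exists_C_mul_eq_map g
    have hgI : g ∈ idealOf (zeroLocus ℚ_[p] I) := fun y hy => hy g hg
    have h1 : g' ∈ integralIdealOf (zeroLocus ℚ_[p] I) := by
      rw [mem_integralIdealOf, ← hg']
      exact Ideal.mul_mem_left _ _ hgI
    have h2 := congrArg (eval (toRat z)) hg'
    rw [aeval_toRat, h g' h1, map_mul, map_C, eval_C] at h2
    have h3 : b = 0 ∨ eval (toRat z) g = 0 := by simpa using h2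
    exact h3.resolve_left hb

/-- Splitting off the identity block solves `B v = 0` for the coordinates `e i` in terms of the
others. -/
theorem sum_eq_add_sum_compl {R : Type*} [CommRing R] {r : ℕ} (e : Fin r ↪ Fin n)
    [Fintype {j // j ∉ Set.range e}] (B : Matrix (Fin r) (Fin n) R)
    (hB : ∀ i k, B i (e k) = (1 : Matrix (Fin r) (Fin r) R) i k) (v : Fin n → R) (i : Fin r) :
    ∑ j, B i j * v j = v (e i) + ∑ k : {j // j ∉ Set.range e}, B i k * v k := by
  classical
  have h : ∀ G : Fin n → R, ∑ j, G j = ∑ a, G (e a) + ∑ k : {j // j ∉ Set.range e}, G k := by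
    intro G
    rw [← Fintype.sum_subtype_add_sum_subtype (fun j => j ∈ Set.range e) G]
    congr 1
    · convert (Fintype.sum_equiv (Equiv.ofInjective e e.injective) (fun a => G (e a))
        (fun k : Set.range e => G k) fun _ => rfl).symm
    · congr!
  rw [h]
  simp [hB, Matrix.one_apply]

/-- The number of points modulo powers of `p` of an algebraic set in a ball around a point where a
maximal minor of the Jacobian matrix of local equations divides all others as well as `p^k`. -/
theorem pointCount_ball_of_dvd {V : Set (Fin n → ℚ_[p])} (hV : IsAlgebraic V)
    {x : Fin n → ℤ_[p]} (hxV : toRat x ∈ V) {r d : ℕ} (hrd : r + d = n)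
    {f : Fin r → MvPolynomial (Fin n) ℤ_[p]} (hf : IsLocalEquations V x f) (e : Fin r ↪ Fin n)
    (he : ((jacobianMatrix f x).submatrix id e).det ≠ 0)
    (hdvd : ∀ φ : Fin r → Fin n, ((jacobianMatrix f x).submatrix id e).det ∣
      ((jacobianMatrix f x).submatrix id φ).det)
    (k : ℕ) (hk : ((jacobianMatrix f x).submatrix id e).det ∣ (p : ℤ_[p]) ^ k) (m : ℕ) :
    pointCount (m + (k + 1)) (integralPoints V ∩ ball x (k + 1)) = p ^ (m * d) := by
  classical
  have hcomplete : IsAdicComplete (Ideal.span {(p : ℤ_[p])}) ℤ_[p] := isAdicComplete_span_p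
  have hp0 : (p : ℤ_[p]) ≠ 0 := PadicInt.prime_p.ne_zero
  set c : ℤ_[p] := (p : ℤ_[p]) ^ k with hc
  have hc0 : c ≠ 0 := pow_ne_zero _ hp0
  have hfx : ∀ k, eval x (f k) = 0 := fun k => (mem_integralPoints_iff hV x).1 hxV _ (hf.1 k)
  obtain ⟨B, P, hB1, hP, hBP⟩ := exists_straightening x f hfx (jacobianMatrix f x)
    (fun _ _ => rfl) e he hdvd c hc0 hk
  have hP1 : ∀ j, P j ∈ idealOfVars (Fin n) ℤ_[p] := fun j =>
    Ideal.pow_le_self two_ne_zero (hP j)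
  let κ := {j // j ∉ Set.range e}
  have hκ : Fintype.card κ = d := by
    have h1 := Fintype.card_subtype_compl (fun j => j ∈ Set.range e)
    have h2 : Fintype.card {j // j ∈ Set.range e} = r := by
      rw [← Fintype.card_congr (Equiv.ofInjective e e.injective), Fintype.card_fin]
    rw [h2, Fintype.card_fin] at h1
    have h3 : Fintype.card κ = n - r := h1
    omega
  -- The kernel of `B` in `(pℤ_p)^n`: coordinates outside `e` are free multiples of `p`, those in
  -- `e` are determined.
  let w : (κ → ℤ_[p]) → Fin n → ℤ_[p] := fun s j =>
    if h : ∃ i, e i = j then -∑ k : κ, B h.choose k * (p * s k) else p * s ⟨j, h⟩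
  have hwe : ∀ s i, w s (e i) = -∑ k : κ, B i k * (p * s k) := by
    intro s i
    have h : ∃ i', e i' = e i := ⟨i, rfl⟩
    have h2 : h.choose = i := e.injective h.choose_spec
    simp only [w, dif_pos h, h2]
  have hwκ : ∀ s (k : κ), w s k = p * s k := fun s k => dif_neg k.2
  have hsplit := sum_eq_add_sum_compl e B hB1
  have hpI : ∀ a : ℤ_[p], (p : ℤ_[p]) * a ∈ Ideal.span {(p : ℤ_[p])} := fun a =>
    Ideal.mul_mem_right _ _ (Ideal.mem_span_singleton_self _)
  have hwI : ∀ s j, w s j ∈ Ideal.span {(p : ℤ_[p])} := by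
    intro s j
    by_cases h : j ∈ Set.range e
    · obtain ⟨i, rfl⟩ := h
      rw [hwe]
      exact neg_mem (Ideal.sum_mem _ fun k _ => Ideal.mul_mem_left _ _ (hpI _))
    · exact hwκ s ⟨j, h⟩ ▸ hpI _
  have hBw : ∀ s i, ∑ j, B i j * w s j = 0 := by
    intro s i
    rw [hsplit, hwe]
    simp only [hwκ]
    exact neg_add_cancel _
  choose u huI hu using fun s => exists_add_aeval_eq (A := ℤ_[p]) _ P hP (w s) (hwI s)
  let φ : (κ → ℤ_[p]) → Fin n → ℤ_[p] := fun s j => x j + c * u s j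
  have hrange : Set.range φ = integralPoints V ∩ ball x (k + 1) := by
    ext z
    constructor
    · rintro ⟨s, rfl⟩
      refine ⟨(mem_integralPoints_iff hV _).2 fun g hg => ?_, mem_ball_iff.2 fun j => ?_⟩
      · obtain ⟨h, hh, hhg⟩ := hf.2 g hg
        exact eval_eq_zero_of_straightening x c f B P hP hBP g h hh hhg (u s) (huI s) fun i => by
          simp only [hu]
          exact hBw s i
      · simp only [φ, add_sub_cancel_left, pow_succ]
        exact mul_dvd_mul_left _ (Ideal.mem_span_singleton.1 (huI s j))
    · rintro ⟨hzV, hzb⟩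
      choose t ht using mem_ball_iff.1 hzb
      have hz : z = fun j => x j + c * (p * t j) := by
        funext j
        rw [hc, ← mul_assoc, ← pow_succ, ← ht]
        ring
      have hft := (hBP ℤ_[p] Function.injective_id fun j => p * t j).1 fun k => by
        have := (mem_integralPoints_iff hV z).1 hzV _ (hf.1 k)
        rw [hz] at this
        exact this
      set F : Fin n → ℤ_[p] := fun j => p * t j + aeval (fun j => p * t j) (P j) with hF
      have hFI : ∀ j, F j ∈ Ideal.span {(p : ℤ_[p])} := fun j =>
        add_mem (hpI _) (aeval_mem_of_mem_idealOfVars _ _ (fun j => hpI _) (hP1 j))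
      choose s hs using fun k : κ => Ideal.mem_span_singleton.1 (hFI k)
      have hwF : w s = F := by
        funext j
        by_cases h : j ∈ Set.range e
        · obtain ⟨i, rfl⟩ := h
          have h1 : ∑ j, B i j * F j = 0 := hft i
          rw [hsplit] at h1
          rw [hwe, eq_neg_of_add_eq_zero_left h1]
          simp only [hs]
          rfl
        · exact (hwκ s ⟨j, h⟩).trans (hs ⟨j, h⟩).symm
      refine ⟨s, ?_⟩
      have : u s = fun j => p * t j :=
        eq_of_add_aeval_eq (A := ℤ_[p]) (Ideal.span {(p : ℤ_[p])}) P hP _ _ (huI s)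
          (fun j => hpI _) fun j => by rw [hu, hwF]
      rw [hz]
      funext j
      simp only [φ, this]
  rw [← hrange, ← hκ]
  refine pointCount_range m (m + (k + 1)) φ fun s s' => ?_
  -- Congruence modulo `p^(m+k+1)` loses `p^k` to the scaling `c`; a last factor `p` goes to the
  -- parametrization `w`, leaving `p^m` for `s`.
  have h1 : (∀ j, (p : ℤ_[p]) ^ (m + (k + 1)) ∣ φ s j - φ s' j) ↔
      ∀ j, u s j - u s' j ∈ Ideal.span {(p : ℤ_[p])} ^ (m + 1) := by
    refine forall_congr' fun j => ?_
    rw [Ideal.span_singleton_pow, Ideal.mem_span_singleton]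
    have h2 : φ s j - φ s' j = (p : ℤ_[p]) ^ k * (u s j - u s' j) := by
      simp only [φ, ← hc]; ring
    have h3 : (p : ℤ_[p]) ^ (m + (k + 1)) = p ^ k * p ^ (m + 1) := by ring
    rw [h2, h3]
    exact mul_dvd_mul_iff_left hc0
  rw [h1, ← sub_mem_pow_iff _ P hP _ _ (huI s) (huI s')]
  simp only [hu, Ideal.span_singleton_pow, Ideal.mem_span_singleton]
  have h4 : ∀ k : κ, w s k - w s' k = p * (s k - s' k) := fun k => by
    rw [hwκ, hwκ]; ring
  constructor
  · intro h j
    have h5 := h j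
    rw [h4, pow_succ'] at h5
    exact (mul_dvd_mul_iff_left hp0).1 h5
  · intro h j
    have h6 : ∀ k : κ, (p : ℤ_[p]) ^ (m + 1) ∣ p * (s k - s' k) := fun k => by
      rw [pow_succ']
      exact mul_dvd_mul_left _ (h k)
    by_cases hj : j ∈ Set.range e
    · obtain ⟨i, rfl⟩ := hj
      have h7 : w s (e i) - w s' (e i) = -∑ k : κ, B i k * (p * (s k - s' k)) := by
        rw [hwe, hwe]
        simp only [mul_sub, Finset.sum_sub_distrib]
        ring
      rw [h7, dvd_neg]
      exact Finset.dvd_sum fun k _ => Dvd.dvd.mul_left (h6 k) _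
    · exact (h4 ⟨j, hj⟩) ▸ h6 ⟨j, hj⟩

end

/-! ### The explicit radius, and gluing over a compact set. -/

section

open MvPolynomial

variable {p : ℕ} [Fact p.Prime] {n : ℕ}

/-- The maximum in the definition of `absJacobian` is attained at an embedding whose minor divides
all minors. -/
theorem exists_absJacobian_eq {r : ℕ} (f : Fin r → MvPolynomial (Fin n) ℤ_[p])
    (x : Fin n → ℤ_[p])
    (h : ∃ e : Fin r ↪o Fin n, ((jacobianMatrix f x).submatrix id e).det ≠ 0) :
    ∃ e : Fin r ↪o Fin n, ((jacobianMatrix f x).submatrix id e).det ≠ 0 ∧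
      absJacobian f x = ‖((jacobianMatrix f x).submatrix id e).det‖ ∧
      ∀ φ : Fin r → Fin n, ((jacobianMatrix f x).submatrix id e).det ∣
        ((jacobianMatrix f x).submatrix id φ).det := by
  classical
  set J := jacobianMatrix f x with hJ
  obtain ⟨e₀, he₀⟩ := h
  have : Nonempty (Fin r ↪o Fin n) := ⟨e₀⟩
  have : Finite (Fin r ↪o Fin n) := Finite.of_injective _ RelEmbedding.toEmbedding_injective
  obtain ⟨e, he⟩ := Finite.exists_max fun e : Fin r ↪o Fin n => ‖(J.submatrix id e).det‖
  have hne : (J.submatrix id e).det ≠ 0 := by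
    rw [← norm_pos_iff]
    exact (norm_pos_iff.2 he₀).trans_le (he e₀)
  refine ⟨e, hne, le_antisymm (ciSup_le he) 
    (le_ciSup (f := fun e : Fin r ↪o Fin n => ‖(J.submatrix id e).det‖)
      (Set.finite_range _).bddAbove e),
    fun φ => dvd_of_norm_le ?_⟩
  -- An injective `φ` is an order embedding up to a permutation, which changes the minor by a sign;
  -- otherwise two columns coincide.
  by_cases hφ : Function.Injective φ
  · obtain ⟨e', σ, rfl⟩ := exists_orderEmb_comp_perm φ hφ
    have h1 : J.submatrix id (e' ∘ σ) = (J.submatrix id e').submatrix id σ := rfl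
    rw [h1, Matrix.det_permute', norm_mul]
    refine (mul_le_of_le_one_left (norm_nonneg _) (PadicInt.norm_le_one _)).trans (he e')
  · obtain ⟨i, j, hij, hne⟩ : ∃ i j, φ i = φ j ∧ i ≠ j := by
      simpa [Function.Injective] using hφ
    rw [Matrix.det_zero_of_column_eq hne (fun k => by simp [hij]), norm_zero]
    exact norm_nonneg _

theorem pointCount_ball_of_isLocalEquations {V : Set (Fin n → ℚ_[p])} (hV : IsAlgebraic V)
    {x : Fin n → ℤ_[p]} {r d : ℕ} (hx : IsSmoothPoint V d (toRat x)) (hrd : r + d = n)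
    {f : Fin r → MvPolynomial (Fin n) ℤ_[p]} (hf : IsLocalEquations V x f) (mx : ℕ)
    (hmx : 0 < mx) (hlog : -Real.logb p (absJacobian f x ^ 2) ≤ mx) (ℓ₁ ℓ₂ : ℕ) (h2 : mx ≤ ℓ₂)
    (h12 : ℓ₂ ≤ ℓ₁) :
    pointCount ℓ₁ (integralPoints V ∩ ball x ℓ₂) = p ^ ((ℓ₁ - ℓ₂) * d) := by
  have hp1 : (1 : ℝ) < p := by exact_mod_cast (Fact.out : p.Prime).one_lt
  obtain ⟨e, he, habs, hdvd⟩ := exists_absJacobian_eq f x (exists_minor_ne_zero hx hrd hf)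
  set δ := ((jacobianMatrix f x).submatrix id e).det with hδ
  have hval : 2 * δ.valuation ≤ mx := by
    rw [habs, PadicInt.norm_eq_zpow_neg_valuation he, Real.logb_pow, ← Real.rpow_intCast,
      Real.logb_rpow (by linarith) hp1.ne'] at hlog
    have h3 : ((2 * δ.valuation : ℕ) : ℝ) ≤ mx := by
      push_cast at hlog ⊢
      linarith
    exact_mod_cast h3
  obtain ⟨k, rfl⟩ : ∃ k, ℓ₂ = k + 1 := ⟨ℓ₂ - 1, by omega⟩
  obtain ⟨m, rfl⟩ := Nat.exists_eq_add_of_le' h12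
  -- With `v` the valuation of `δ`, `2 v ≤ ℓ₂` and `ℓ₂ ≥ 1` give `v ≤ ℓ₂ - 1 = k`; positivity of
  -- `mx` covers the case `v = 0`.
  have hk : δ ∣ (p : ℤ_[p]) ^ k := by
    apply dvd_of_norm_le
    rw [PadicInt.norm_p_pow, PadicInt.norm_eq_zpow_neg_valuation he]
    exact zpow_le_zpow_right₀ hp1.le (by omega)
  rw [Nat.add_sub_cancel]
  exact pointCount_ball_of_dvd hV hx.1 hrd hf e.toEmbedding he hdvd k hk m

theorem exists_pointCount_ball_eq {V : Set (Fin n → ℚ_[p])} (hV : IsAlgebraic V)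
    {x : Fin n → ℤ_[p]} {d : ℕ} (hx : IsSmoothPoint V d (toRat x)) :
    ∃ mx : ℕ, 0 < mx ∧ ∀ ℓ₁ ℓ₂ : ℕ, mx ≤ ℓ₂ → ℓ₂ ≤ ℓ₁ →
      pointCount ℓ₁ (integralPoints V ∩ ball x ℓ₂) = p ^ ((ℓ₁ - ℓ₂) * d) := by
  obtain ⟨r, f, hrd, hf⟩ := exists_isLocalEquations hx
  obtain ⟨N, hN⟩ := exists_nat_ge (-Real.logb p (absJacobian f x ^ 2))
  refine ⟨N + 1, N.succ_pos, fun ℓ₁ ℓ₂ h2 h12 =>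
    pointCount_ball_of_isLocalEquations hV hx hrd hf (N + 1) N.succ_pos ?_ ℓ₁ ℓ₂ h2 h12⟩
  push_cast
  linarith

theorem mem_ball_self (x : Fin n → ℤ_[p]) (ℓ : ℕ) : x ∈ ball x ℓ :=
  mem_ball_iff.2 fun j => by simp

/-- The ultrametric inequality; it makes two balls either nested or disjoint. -/
theorem ball_subset_ball {x y : Fin n → ℤ_[p]} {k ℓ : ℕ} (hkl : k ≤ ℓ)
    (h : (ball x k ∩ ball y ℓ).Nonempty) : ball y ℓ ⊆ ball x k := by
  obtain ⟨z, hz, hz'⟩ := h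
  intro w hw
  rw [mem_ball_iff] at *
  intro j
  have h1 := pow_dvd_pow (p : ℤ_[p]) hkl
  have h2 : w j - x j = (w j - y j) - (z j - y j) + (z j - x j) := by ring
  rw [h2]
  exact dvd_add (dvd_sub (h1.trans (hw j)) (h1.trans (hz' j))) (hz j)

theorem isOpen_ball (x : Fin n → ℤ_[p]) (ℓ : ℕ) : IsOpen (ball x ℓ) := by
  have hp : (p : ℝ) ^ (-(ℓ : ℤ)) ≠ 0 :=
    zpow_ne_zero _ (by exact_mod_cast (Fact.out : p.Prime).ne_zero)
  exact IsUltrametricDist.isOpen_closedBall x hp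

theorem exists_ball_subset {x : Fin n → ℤ_[p]} {U : Set (Fin n → ℤ_[p])} (hU : IsOpen U)
    (hx : x ∈ U) : ∃ k : ℕ, ∀ ℓ, k ≤ ℓ → ball x ℓ ⊆ U := by
  have hp1 : (1 : ℝ) < p := by exact_mod_cast (Fact.out : p.Prime).one_lt
  obtain ⟨ε, hε, hball⟩ := Metric.isOpen_iff.1 hU x hx
  obtain ⟨k, hk⟩ := PadicInt.exists_pow_neg_lt p hε
  refine ⟨k, fun ℓ hℓ => (Metric.closedBall_subset_ball ?_).trans hball⟩
  exact (zpow_le_zpow_right₀ hp1.le (by omega)).trans_lt hk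

theorem pointCount_union {S T : Set (Fin n → ℤ_[p])} (m : ℕ)
    (h : ∀ s ∈ S, ∀ t ∈ T, ¬ ∀ j, (p : ℤ_[p]) ^ m ∣ s j - t j) :
    pointCount m (S ∪ T) = pointCount m S + pointCount m T := by
  have hp : p ≠ 0 := (Fact.out : p.Prime).ne_zero
  have : NeZero (p ^ m) := ⟨pow_ne_zero _ hp⟩
  rw [pointCount, Set.image_union, Set.ncard_union_eq _ (Set.toFinite _) (Set.toFinite _)]
  · rfl
  · rw [Set.disjoint_left]
    rintro _ ⟨s, hs, rfl⟩ ⟨t, ht, hst⟩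
    exact h s hs t ht fun j => (toZModPow_eq_iff m _ _).1 (congrFun hst j).symm

/-- A finite union of balls is a disjoint union of some of these balls. -/
theorem exists_pairwiseDisjoint_balls (T : Finset ((Fin n → ℤ_[p]) × ℕ)) :
    ∃ T' ⊆ T, (∀ b ∈ T', ∀ c ∈ T', b ≠ c → Disjoint (ball b.1 b.2) (ball c.1 c.2)) ∧
      ∀ b ∈ T, ∃ c ∈ T', ball b.1 b.2 ⊆ ball c.1 c.2 := by
  classical
  induction T using Finset.induction_on with
  | empty => exact ⟨∅, by simp⟩
  | insert a T _ ih =>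
    obtain ⟨T', hT', hdis, hcov⟩ := ih
    by_cases h : ∃ c ∈ T', ball a.1 a.2 ⊆ ball c.1 c.2
    · refine ⟨T', hT'.trans (Finset.subset_insert _ _), hdis, fun b hb => ?_⟩
      rcases Finset.mem_insert.1 hb with rfl | hb
      · exact h
      · exact hcov b hb
    · push Not at h
      have hmeet : ∀ c ∈ T', ¬ Disjoint (ball c.1 c.2) (ball a.1 a.2) →
          ball c.1 c.2 ⊆ ball a.1 a.2 := by
        intro c hc hd
        rw [Set.not_disjoint_iff_nonempty_inter] at hd
        rcases le_total c.2 a.2 with hle | hle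
        · exact absurd (ball_subset_ball hle hd) (h c hc)
        · exact ball_subset_ball hle (Set.inter_comm _ _ ▸ hd)
      -- No ball of `T'` contains the new one, so each that meets it lies inside it and can be
      -- discarded.
      refine ⟨insert a (T'.filter fun c => Disjoint (ball c.1 c.2) (ball a.1 a.2)), ?_, ?_, ?_⟩
      · exact Finset.insert_subset_insert _ ((Finset.filter_subset _ _).trans hT')
      · intro b hb c hc hbc
        rw [Finset.mem_insert, Finset.mem_filter] at hb hc
        rcases hb with rfl | ⟨hb, hba⟩ <;> rcases hc with rfl | ⟨hc, hca⟩
        · exact absurd rfl hbc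
        · exact hca.symm
        · exact hba
        · exact hdis b hb c hc hbc
      · intro b hb
        rcases Finset.mem_insert.1 hb with rfl | hb
        · exact ⟨b, Finset.mem_insert_self _ _, subset_rfl⟩
        · obtain ⟨c, hc, hbc⟩ := hcov b hb
          by_cases hd : Disjoint (ball c.1 c.2) (ball a.1 a.2)
          · exact ⟨c, Finset.mem_insert_of_mem (Finset.mem_filter.2 ⟨hc, hd⟩), hbc⟩
          · exact ⟨a, Finset.mem_insert_self _ _, hbc.trans (hmeet c hc hd)⟩

theorem pointCount_empty (m : ℕ) : pointCount m (∅ : Set (Fin n → ℤ_[p])) = 0 := by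
  rw [pointCount, Set.image_empty, Set.ncard_empty]

/-- At a level `m` at least as fine as all the radii, points congruent modulo `p^m` lie in the same
ball, so no residue is counted twice. -/
theorem pointCount_biUnion_balls (A : Set (Fin n → ℤ_[p])) (T : Finset ((Fin n → ℤ_[p]) × ℕ))
    (hT : ∀ b ∈ T, ∀ c ∈ T, b ≠ c → Disjoint (ball b.1 b.2) (ball c.1 c.2)) (m : ℕ)
    (hm : ∀ b ∈ T, b.2 ≤ m) :
    pointCount m (⋃ b ∈ T, A ∩ ball b.1 b.2) = ∑ b ∈ T, pointCount m (A ∩ ball b.1 b.2) := by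
  classical
  induction T using Finset.induction_on with
  | empty => simpa using pointCount_empty m
  | insert a T ha ih =>
    rw [Finset.set_biUnion_insert, Finset.sum_insert ha, pointCount_union, ih]
    · exact fun b hb c hc => hT b (Finset.mem_insert_of_mem hb) c (Finset.mem_insert_of_mem hc)
    · exact fun b hb => hm b (Finset.mem_insert_of_mem hb)
    · intro s hs t ht hst
      simp only [Set.mem_iUnion] at ht
      obtain ⟨b, hb, -, htb⟩ := ht
      have hd := hT a (Finset.mem_insert_self _ _) b (Finset.mem_insert_of_mem hb)
        (fun h => ha (h ▸ hb))
      have hst' : t ∈ ball s m := mem_ball_iff.2 fun j => by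
        rw [← neg_sub, dvd_neg]
        exact hst j
      have hsub : ball s m ⊆ ball a.1 a.2 := ball_subset_ball (hm a (Finset.mem_insert_self _ _))
        ⟨s, hs.2, mem_ball_self s m⟩
      exact Set.disjoint_left.1 hd (hsub hst') htb

/-- Stabilization of the point counts for compact open subsets of the smooth part. -/
theorem exists_pointCount_eq_of_isCompact {V : Set (Fin n → ℚ_[p])} (hV : IsAlgebraic V) {d : ℕ}
    {X U : Set (Fin n → ℤ_[p])} (hX : IsCompact X) (hU : IsOpen U)
    (hXU : X = integralPoints V ∩ U) (hsm : ∀ x ∈ X, IsSmoothPoint V d (toRat x)) :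
    ∃ m₀ : ℕ, 0 < m₀ ∧ ∀ m : ℕ, m₀ ≤ m →
      pointCount m X = p ^ ((m - m₀) * d) * pointCount m₀ X := by
  classical
  -- The radius is small enough both for the ball to lie in `U` and for the local count to hold.
  have hloc : ∀ x : X, ∃ k : ℕ, ball x.1 k ⊆ U ∧ ∀ ℓ, k ≤ ℓ →
      pointCount ℓ (integralPoints V ∩ ball x.1 k) = p ^ ((ℓ - k) * d) := by
    rintro ⟨x, hx⟩
    obtain ⟨mx, -, hmx⟩ := exists_pointCount_ball_eq hV (hsm x hx)
    obtain ⟨k, hk⟩ := exists_ball_subset hU (hXU ▸ hx : x ∈ integralPoints V ∩ U).2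
    exact ⟨max k mx, hk _ (le_max_left _ _), fun ℓ hℓ => hmx _ _ (le_max_right _ _) hℓ⟩
  choose k hkU hk using hloc
  obtain ⟨t, ht⟩ := hX.elim_finite_subcover (fun x : X => ball x.1 (k x))
    (fun x => isOpen_ball _ _) fun x hx => Set.mem_iUnion.2 ⟨⟨x, hx⟩, mem_ball_self _ _⟩
  obtain ⟨T, hTt, hdis, hcov⟩ := exists_pairwiseDisjoint_balls (t.image fun x : X => (x.1, k x))
  have hTX : ∀ b ∈ T, ball b.1 b.2 ⊆ U ∧ ∀ ℓ, b.2 ≤ ℓ →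
      pointCount ℓ (integralPoints V ∩ ball b.1 b.2) = p ^ ((ℓ - b.2) * d) := by
    intro b hb
    obtain ⟨x, -, rfl⟩ := Finset.mem_image.1 (hTt hb)
    exact ⟨hkU x, hk x⟩
  have hXT : X = ⋃ b ∈ T, integralPoints V ∩ ball b.1 b.2 := by
    apply Set.Subset.antisymm
    · intro x hx
      have h1 := ht hx
      simp only [Set.mem_iUnion] at h1
      obtain ⟨y, hy, hxy⟩ := h1
      obtain ⟨c, hc, hyc⟩ := hcov _ (Finset.mem_image_of_mem _ hy)
      simp only [Set.mem_iUnion]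
      exact ⟨c, hc, (hXU ▸ hx : x ∈ integralPoints V ∩ U).1, hyc hxy⟩
    · intro x hx
      simp only [Set.mem_iUnion] at hx
      obtain ⟨b, hb, hxV, hxb⟩ := hx
      rw [hXU]
      exact ⟨hxV, (hTX b hb).1 hxb⟩
  have hcount : ∀ m, T.sup Prod.snd ≤ m →
      pointCount m X = ∑ b ∈ T, p ^ ((m - b.2) * d) := by
    intro m hm
    have hle : ∀ b ∈ T, b.2 ≤ m := fun b hb => (Finset.le_sup (f := Prod.snd) hb).trans hm
    rw [hXT, pointCount_biUnion_balls _ T hdis m hle]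
    exact Finset.sum_congr rfl fun b hb => (hTX b hb).2 m (hle b hb)
  -- Any level beyond all the radii works, since every summand then grows by the same factor; the `+
  -- 1` only ensures positivity.
  refine ⟨T.sup Prod.snd + 1, Nat.succ_pos _, fun m hm => ?_⟩
  rw [hcount m (by omega), hcount _ (Nat.le_succ _), Finset.mul_sum]
  refine Finset.sum_congr rfl fun b hb => ?_
  have hb' : b.2 ≤ T.sup Prod.snd := Finset.le_sup (f := Prod.snd) hb
  rw [← pow_add, ← add_mul]
  congr 2
  omega

end

end PadicSet

theorem mainTheorem9 (p : ℕ) [Fact p.Prime] (n d : ℕ) (V : Set (Fin n → ℚ_[p]))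
    (hV : PadicSet.IsAlgebraic V) :
    -- stabilization for compact open subsets of the smooth `d`-dimensional part of `V ∩ ℤ_p^n`
    (∀ X : Set (Fin n → ℤ_[p]), IsCompact X →
      (∃ U : Set (Fin n → ℤ_[p]), IsOpen U ∧ X = PadicSet.integralPoints V ∩ U) →
      (∀ x ∈ X, PadicSet.IsSmoothPoint V d (PadicSet.toRat x)) →
      ∃ m₀ : ℕ, 0 < m₀ ∧ ∀ m : ℕ, m₀ ≤ m →
        PadicSet.pointCount m X = p ^ ((m - m₀) * d) * PadicSet.pointCount m₀ X) ∧
    -- the local statement at a smooth point, with the explicit radius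
    (∀ x : Fin n → ℤ_[p], PadicSet.IsSmoothPoint V d (PadicSet.toRat x) →
      (∃ mx : ℕ, 0 < mx ∧ ∀ ℓ₁ ℓ₂ : ℕ, mx ≤ ℓ₂ → ℓ₂ ≤ ℓ₁ →
        PadicSet.pointCount ℓ₁ (PadicSet.integralPoints V ∩ PadicSet.ball x ℓ₂) =
          p ^ ((ℓ₁ - ℓ₂) * d)) ∧
      (∀ r : ℕ, r + d = n → ∀ f : Fin r → MvPolynomial (Fin n) ℤ_[p],
        PadicSet.IsLocalEquations V x f →
        ∀ mx : ℕ, 0 < mx → -Real.logb p (PadicSet.absJacobian f x ^ 2) ≤ mx →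
        ∀ ℓ₁ ℓ₂ : ℕ, mx ≤ ℓ₂ → ℓ₂ ≤ ℓ₁ →
          PadicSet.pointCount ℓ₁ (PadicSet.integralPoints V ∩ PadicSet.ball x ℓ₂) =
            p ^ ((ℓ₁ - ℓ₂) * d))) := by
  refine ⟨fun X hX ⟨U, hU, hXU⟩ hsm => PadicSet.exists_pointCount_eq_of_isCompact hV hX hU hXU hsm,
    fun x hx => ⟨PadicSet.exists_pointCount_ball_eq hV hx, ?_⟩⟩
  intro r hr f hf mx hmx hlog ℓ₁ ℓ₂ h2 h12
  exact PadicSet.pointCount_ball_of_isLocalEquations hV hx hr hf mx hmx hlog ℓ₁ ℓ₂ h2 h12
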